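/- For $n\in\mathbb N$, $n\ge 1$, and $\frac1{8\pi}<A<\frac1{4\pi}$ let $U_n(y)=y+\frac An\sin(4n\pi y)$, $y\in[0,1]$. Consider the Rayleigh equation $$U_n''\phi-(U_n-c)(\phi''-\alpha^2\phi)=0\ \text{ on }(0,1),\qquad \phi(0)=\phi(1)=0. \tag{R}$$ A pair $(\alpha,c)$ with $\alpha>0$, $c\in\mathbb C$ is an eigenmode if (R) has a nontrivial solution $\phi\in C^2(0,1)\cap C[0,1]$ (an eigenfunction); it is unstable if $\operatorname{Im}c>0$ and neutral if $\operatorname{Im}c=0$. There is a constant $c_0>0$, independent of $n$ and $A$, such that for all such $A$ and all $n\ge1$ the following hold. (1) The shear $(U_n(y),0)$ is linearly unstable under the 2D Euler dynamics in the channel $\mathbb R\times[0,1]$: for some $L>0$, the 2D Euler equations linearized at $(U_n,0)$, with no flow through the walls $y=0,1$ and with velocity and pressure $L$-periodic in $x$, have a smooth solution $e^{\lambda t}(u(x,y),v(x,y),p(x,y))$ with $\operatorname{Re}\lambda>0$ and $(u,v)\not\equiv0$. (2) There are a number $\alpha_n\ge c_0n$ such that $(\alpha_n,\frac12)$ is a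 neutral mode, a $\delta>0$, and a continuous curve $c:(\alpha_n-\delta,\alpha_n]\to\mathbb C$ with $c(\alpha_n)=\frac12$, such that for every $\alpha\in(\alpha_n-\delta,\alpha_n)$ the pair $(\alpha,c(\alpha))$ is an unstable eigenmode, and every corresponding eigenfunction is in $C^\infty(0,1)$. -/

import Mathlib

open Set

noncomputable section

/-- The oscillatory shear profile `U_n(y) = y + (A / n) sin (4 n π y)`. -/
def oscillatoryShear (A : ℝ) (n : ℕ) (y : ℝ) : ℝ :=
  y + A / n * Real.sin (4 * n * Real.pi * y)

/-- `(u, v, p)` (perturbation velocity and pressure, as functions of `t, x, y`) is a smooth solution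
of the 2D Euler equations linearized at the steady shear `(U(y), 0)` in the channel
`ℝ × [0, 1]`, periodic in `x` with period `L`, with no flow through the walls.
Only the values for `0 ≤ y ≤ 1` matter. -/
structure IsLinearizedEulerSolution (U : ℝ → ℝ) (L : ℝ) (u v p : ℝ → ℝ → ℝ → ℂ) : Prop where
  smooth_u : ContDiffOn ℝ (⊤ : ℕ∞) (fun q : ℝ × ℝ × ℝ => u q.1 q.2.1 q.2.2)
    (univ ×ˢ univ ×ˢ Icc 0 1)
  smooth_v : ContDiffOn ℝ (⊤ : ℕ∞) (fun q : ℝ × ℝ × ℝ => v q.1 q.2.1 q.2.2)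
    (univ ×ˢ univ ×ˢ Icc 0 1)
  smooth_p : ContDiffOn ℝ (⊤ : ℕ∞) (fun q : ℝ × ℝ × ℝ => p q.1 q.2.1 q.2.2)
    (univ ×ˢ univ ×ˢ Icc 0 1)
  periodic : ∀ t x, ∀ y ∈ Icc (0 : ℝ) 1,
    u t (x + L) y = u t x y ∧ v t (x + L) y = v t x y ∧ p t (x + L) y = p t x y
  momentum_x : ∀ t x, ∀ y ∈ Ioo (0 : ℝ) 1,
    deriv (fun s => u s x y) t + (U y : ℂ) * deriv (fun s => u t s y) x
      + v t x y * ((deriv U y : ℝ) : ℂ) = - deriv (fun s => p t s y) x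
  momentum_y : ∀ t x, ∀ y ∈ Ioo (0 : ℝ) 1,
    deriv (fun s => v s x y) t + (U y : ℂ) * deriv (fun s => v t s y) x
      = - deriv (fun s => p t x s) y
  incompressible : ∀ t x, ∀ y ∈ Ioo (0 : ℝ) 1,
    deriv (fun s => u t s y) x + deriv (fun s => v t x s) y = 0
  impermeable : ∀ t x, v t x 0 = 0 ∧ v t x 1 = 0

/-- The shear `(U(y), 0)` is linearly unstable under the 2D Euler dynamics: for some period in `x`,
the linearized Euler equations have an unstable eigenvalue, that is, a solution `e^{λ t} (u, v)`
with `Re λ > 0` and `(u, v)` not identically zero. -/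
def IsLinearlyUnstable (U : ℝ → ℝ) : Prop :=
  ∃ L : ℝ, 0 < L ∧ ∃ lam : ℂ, 0 < lam.re ∧ ∃ u v p : ℝ → ℝ → ℂ,
    (∃ x, ∃ y ∈ Icc (0 : ℝ) 1, u x y ≠ 0 ∨ v x y ≠ 0) ∧
    IsLinearizedEulerSolution U L
      (fun t x y => Complex.exp (lam * t) * u x y)
      (fun t x y => Complex.exp (lam * t) * v x y)
      (fun t x y => Complex.exp (lam * t) * p x y)

/-- `φ` is an eigenfunction of the Rayleigh equation
`U'' φ - (U - c) (φ'' - α² φ) = 0` on `(0, 1)`, `φ(0) = φ(1) = 0`: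
a classical solution that does not vanish identically. -/
structure IsRayleighEigenfunction (U : ℝ → ℝ) (α : ℝ) (c : ℂ) (φ : ℝ → ℂ) : Prop where
  continuousOn : ContinuousOn φ (Icc 0 1)
  contDiffOn : ContDiffOn ℝ 2 φ (Ioo 0 1)
  equation : ∀ y ∈ Ioo (0 : ℝ) 1,
    ((deriv (deriv U) y : ℝ) : ℂ) * φ y
      - ((U y : ℂ) - c) * (deriv (deriv φ) y - (α : ℂ) ^ 2 * φ y) = 0
  left : φ 0 = 0
  right : φ 1 = 0
  nontrivial : ∃ y ∈ Ioo (0 : ℝ) 1, φ y ≠ 0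

/-- `(α, c)` is an eigenmode of the Rayleigh equation with profile `U`. -/
def IsRayleighEigenmode (U : ℝ → ℝ) (α : ℝ) (c : ℂ) : Prop :=
  0 < α ∧ ∃ φ : ℝ → ℂ, IsRayleighEigenfunction U α c φ

/-- An eigenmode with `Im c > 0`. -/
def IsUnstableMode (U : ℝ → ℝ) (α : ℝ) (c : ℂ) : Prop :=
  IsRayleighEigenmode U α c ∧ 0 < c.im

/-- An eigenmode with `Im c = 0`. -/
def IsNeutralMode (U : ℝ → ℝ) (α : ℝ) (c : ℂ) : Prop :=
  IsRayleighEigenmode U α c ∧ c.im = 0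

end

/-! Put s = k(y − 1/2) with k = 4πn, a = 4πA ∈ (1/2, 1), α² = k²μ and c = 1/2 + iε/k. The Rayleigh
equation becomes φ'' = (μ − K_ε)φ on [−ℓ, ℓ], where ℓ = k/2, K_ε = a sin s / (f − iε) and f(s) = s +
a sin s. Since K_ε(−s) is the conjugate of K_ε(s), conjugate reflection preserves the equation.
Hence a solution on [0, ℓ] vanishing at ℓ, divided by its value at 0, extends to an eigenfunction as
soon as R(μ, ε) = Re(φ'(0)/φ(0)) vanishes (`IsTerminalSolution.exists_symmetric_extension`). With Re
c = 1/2 fixed, one real equation in two real unknowns remains.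

For ε = 0 everything is real. Comparison with f, which solves the equation for μ = 0, gives φ > 0 on
[0, ℓ) for μ ≥ 0. Convexity gives R(1, 0) < 0, and a test function gives R(1/144, 0) > 0
(`IsNeutralSolution.deriv_zero_pos`), so R(μ₀, 0) = 0 for some μ₀ ∈ [1/144, 1]. This is the neutral
mode, with α_n = k√μ₀ ≥ n. Sturm comparison gives R(μ, 0) > 0 for 0 ≤ μ < μ₀.

Near (μ₀, 0), R is strictly decreasing in ε ≥ 0. By a Wronskian identity R(μ, ε₁) − R(μ, ε₂) is the
integral of Re((K_ε₁ − K_ε₂)p), with p a product of normalized solutions. The region s ~ ε₂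
contributes at least a fixed multiple of ε₂ − ε₁, and the negative part is a small multiple of it
because p is almost real (`integral_re_rayleighPotential_sub_mul_pos`). Monotonicity then does the
work of an implicit function theorem (`exists_continuousOn_zero_branch`): for μ just below μ₀ there
is a zero ε = e(μ) > 0, continuous in μ and tending to 0. The stream function φ(y)exp(iα(x − ct))
turns such a mode into a growing Euler solution. -/

/-! ### Linear second-order equations with terminal data: existence and stability. -/

/-- Picard iteration contracts on the whole interval at once when the unknown is g = exp(κx)·y: the
weight turns the Lipschitz constant into L/κ < 1/2. Extending g by its endpoint values keeps the
integrand continuous on ℝ, so derivatives are two-sided at the endpoints too. -/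
theorem exists_hasDerivAt_Icc_of_lipschitz {E : Type*} [NormedAddCommGroup E] [NormedSpace ℝ E]
    [CompleteSpace E] {v : ℝ → E → E} {L a b : ℝ} (hL : 0 ≤ L) (hab : a ≤ b)
    (hv : Continuous (Function.uncurry v))
    (hlip : ∀ t ∈ Icc a b, ∀ x y, ‖v t x - v t y‖ ≤ L * ‖x - y‖) (y₀ : E) :
    ∃ y : ℝ → E, Continuous y ∧ y b = y₀ ∧ ∀ x ∈ Icc a b, HasDerivAt y (v x (y x)) x := by
  classical
  set κ : ℝ := 2 * L + 1 with hκ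
  have hκ0 : 0 < κ := by positivity
  let ext : C(Icc a b, E) → ℝ → E := fun g t => Real.exp (-κ * t) • IccExtend hab g t
  have hext : ∀ g, Continuous (ext g) := fun g => by
    have := g.continuous.Icc_extend' (h := hab)
    fun_prop
  have hvext : ∀ g, Continuous fun t => v t (ext g t) := fun g =>
    hv.comp (continuous_id.prodMk (hext g))
  let sol : C(Icc a b, E) → ℝ → E := fun g x => y₀ + ∫ t in b..x, v t (ext g t)
  have hsol : ∀ g x, HasDerivAt (sol g) (v x (ext g x)) x := fun g x =>
    ((hvext g).integral_hasStrictDerivAt b x).hasDerivAt.const_add y₀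
  have hsolc : ∀ g, Continuous (sol g) := fun g =>
    continuous_iff_continuousAt.2 fun x => (hsol g x).continuousAt
  let T : C(Icc a b, E) → C(Icc a b, E) := fun g =>
    ⟨fun x => Real.exp (κ * x) • sol g x, by
      have := hsolc g
      fun_prop⟩
  have hT : ContractingWith (1 / 2) T := by
    refine ⟨by norm_num, LipschitzWith.of_dist_le_mul fun g h => ?_⟩
    rw [ContinuousMap.dist_le (by positivity)]
    intro x
    have hx := x.2
    have hdiff : ∀ t ∈ Icc a b, ‖v t (ext g t) - v t (ext h t)‖ ≤
        L * Real.exp (-κ * t) * dist g h := by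
      intro t ht
      refine (hlip t ht _ _).trans ?_
      rw [mul_assoc]
      refine mul_le_mul_of_nonneg_left ?_ hL
      rw [← smul_sub, norm_smul, Real.norm_eq_abs, Real.abs_exp, IccExtend_of_mem hab _ ht,
        IccExtend_of_mem hab _ ht, ← dist_eq_norm]
      exact mul_le_mul_of_nonneg_left (ContinuousMap.dist_apply_le_dist _) (Real.exp_pos _).le
    have hint : ∫ t in (x : ℝ)..b, L * Real.exp (-κ * t) * dist g h =
        L * dist g h * ((Real.exp (-κ * x) - Real.exp (-κ * b)) / κ) := by
      have : ∀ t ∈ uIcc (x : ℝ) b, HasDerivAt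
          (fun t => L * dist g h * (-(Real.exp (-κ * t)) / κ))
          (L * Real.exp (-κ * t) * dist g h) t := by
        intro t _
        have := (((((hasDerivAt_id t).const_mul (-κ)).exp).neg.div_const κ).const_mul
          (L * dist g h))
        refine this.congr_deriv ?_
        simp only [id]
        field_simp
      rw [intervalIntegral.integral_eq_sub_of_hasDerivAt this
        (Continuous.intervalIntegrable (by fun_prop) _ _)]
      ring
    have hnorm : ‖sol g x - sol h x‖ ≤
        L * dist g h * ((Real.exp (-κ * x) - Real.exp (-κ * b)) / κ) := by
      have : sol g x - sol h x = ∫ t in b..x, (v t (ext g t) - v t (ext h t)) := by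
        rw [intervalIntegral.integral_sub ((hvext g).intervalIntegrable _ _)
          ((hvext h).intervalIntegrable _ _)]
        simp only [sol]; abel
      rw [this, intervalIntegral.integral_symm, norm_neg, ← hint]
      refine intervalIntegral.norm_integral_le_of_norm_le hx.2
        (Filter.Eventually.of_forall fun t ht => hdiff t ⟨hx.1.trans ht.1.le, ht.2⟩)
        (Continuous.intervalIntegrable (by fun_prop) _ _)
    have hd : 0 ≤ dist g h := dist_nonneg
    have : dist (T g x) (T h x) = Real.exp (κ * x) * ‖sol g x - sol h x‖ := by
      simp only [T, ContinuousMap.coe_mk]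
      rw [dist_eq_norm, ← smul_sub, norm_smul, Real.norm_eq_abs, Real.abs_exp]
    rw [this]
    have he : Real.exp (κ * x) * Real.exp (-κ * x) = 1 := by
      rw [← Real.exp_add]; simp
    calc Real.exp (κ * x) * ‖sol g x - sol h x‖
        ≤ Real.exp (κ * x) * (L * dist g h * ((Real.exp (-κ * x)) / κ)) := by
          refine mul_le_mul_of_nonneg_left (hnorm.trans ?_) (Real.exp_pos _).le
          gcongr
          have := Real.exp_pos (-κ * b)
          linarith
      _ = (L / κ) * dist g h * (Real.exp (κ * x) * Real.exp (-κ * x)) := by ring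
      _ ≤ (1 / 2 : NNReal) * dist g h := by
          rw [he, mul_one]
          refine mul_le_mul_of_nonneg_right ?_ hd
          rw [div_le_iff₀ hκ0]
          push_cast
          linarith
  have : Nonempty (Icc a b) := ⟨⟨a, le_rfl, hab⟩⟩
  obtain ⟨g, hg⟩ : ∃ g, T g = g := ⟨_, hT.fixedPoint_isFixedPt⟩
  refine ⟨sol g, hsolc g, by simp [sol], fun x hx => ?_⟩
  have : ext g x = sol g x := by
    have h1 : g ⟨x, hx⟩ = Real.exp (κ * x) • sol g x := by
      conv_lhs => rw [← hg]
      rfl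
    simp only [ext]
    rw [IccExtend_of_mem hab _ hx, h1, smul_smul, ← Real.exp_add]
    simp
  rw [← this]
  exact hsol g x

/-- Grönwall's inequality in integral form, going backwards from `b`. -/
theorem le_mul_exp_of_le_add_mul_integral {u : ℝ → ℝ} {a b k c : ℝ}
    (hk : 0 ≤ k) (hu : Continuous u)
    (h : ∀ x ∈ Icc a b, u x ≤ c + k * ∫ t in x..b, u t) :
    ∀ x ∈ Icc a b, u x ≤ c * Real.exp (k * (b - x)) := by
  intro x hx
  -- Integrating factor: `h` says exactly that w' ≥ 0, and w(b) = c·exp(kb).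
  let w : ℝ → ℝ := fun x => Real.exp (k * x) * (c + k * ∫ t in x..b, u t)
  have hw : ∀ x, HasDerivAt w (Real.exp (k * x) * k * (c + k * ∫ t in x..b, u t)
      + Real.exp (k * x) * (k * (-u x))) x := by
    intro x
    have h1 : HasDerivAt (fun x => ∫ t in x..b, u t) (-u x) x :=
      intervalIntegral.integral_hasDerivAt_left (hu.intervalIntegrable _ _)
        (hu.stronglyMeasurableAtFilter _ _) hu.continuousAt
    have h2 := ((hasDerivAt_id x).const_mul k).exp
    simp only [id, mul_one] at h2
    exact h2.mul ((h1.const_mul k).const_add c)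
  have hmono : MonotoneOn w (Icc a b) := by
    refine monotoneOn_of_deriv_nonneg (convex_Icc a b)
      (fun y _ => (hw y).continuousAt.continuousWithinAt)
      (fun y _ => (hw y).differentiableAt.differentiableWithinAt) fun y hy => ?_
    rw [interior_Icc] at hy
    rw [(hw y).deriv]
    have := h y (Ioo_subset_Icc_self hy)
    have h3 : 0 ≤ Real.exp (k * y) * k := by positivity
    nlinarith [mul_nonneg h3 (sub_nonneg.2 this)]
  have h1 := hmono hx ⟨hx.1.trans hx.2, le_rfl⟩ hx.2
  simp only [w, intervalIntegral.integral_same, mul_zero, add_zero] at h1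
  have h2 := h x hx
  have h3 : Real.exp (k * (b - x)) = Real.exp (k * b) * Real.exp (-(k * x)) := by
    rw [← Real.exp_add]; ring_nf
  have h4 : Real.exp (k * x) * Real.exp (-(k * x)) = 1 := by rw [← Real.exp_add]; simp
  refine h2.trans ?_
  rw [h3]
  calc c + k * ∫ t in x..b, u t
      = (Real.exp (k * x) * Real.exp (-(k * x))) * (c + k * ∫ t in x..b, u t) := by rw [h4, one_mul]
    _ = (Real.exp (k * x) * (c + k * ∫ t in x..b, u t)) * Real.exp (-(k * x)) := by ring
    _ ≤ (Real.exp (k * b) * c) * Real.exp (-(k * x)) := by gcongr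
    _ = _ := by ring

/-- `φ`, with derivative `ψ`, solves the second-order equation with coefficient `Q` on `[0, ℓ]`,
with terminal data `φ ℓ = 0` and `ψ ℓ = -1`. -/
structure IsTerminalSolution (Q : ℝ → ℂ) (ℓ : ℝ) (φ ψ : ℝ → ℂ) : Prop where
  continuous_fst : Continuous φ
  continuous_snd : Continuous ψ
  hasDerivAt_fst : ∀ x ∈ Icc 0 ℓ, HasDerivAt φ (ψ x) x
  hasDerivAt_snd : ∀ x ∈ Icc 0 ℓ, HasDerivAt ψ (Q x * φ x) x
  fst_end : φ ℓ = 0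
  snd_end : ψ ℓ = -1

theorem exists_isTerminalSolution {Q : ℝ → ℂ} {ℓ M : ℝ} (hℓ : 0 ≤ ℓ) (hQ : Continuous Q)
    (hM : ∀ x ∈ Icc 0 ℓ, ‖Q x‖ ≤ M) : ∃ φ ψ, IsTerminalSolution Q ℓ φ ψ := by
  have hM0 : 0 ≤ M := (norm_nonneg _).trans (hM 0 ⟨le_rfl, hℓ⟩)
  obtain ⟨y, hc, hy, hd⟩ := exists_hasDerivAt_Icc_of_lipschitz
    (v := fun t (y : ℂ × ℂ) => (y.2, Q t * y.1)) (L := 1 + M) (a := 0) (b := ℓ)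
    (by positivity) hℓ (by unfold Function.uncurry; fun_prop)
    (fun t ht x y => by
      have h1 : ‖x.1 - y.1‖ ≤ ‖x - y‖ := norm_fst_le (x - y)
      have h2 : ‖x.2 - y.2‖ ≤ ‖x - y‖ := norm_snd_le (x - y)
      have h3 := norm_nonneg (x - y)
      refine max_le ?_ ?_
      · change ‖x.2 - y.2‖ ≤ _
        nlinarith
      · change ‖Q t * x.1 - Q t * y.1‖ ≤ _
        rw [← mul_sub, norm_mul]
        have := mul_le_mul (hM t ht) h1 (norm_nonneg _) hM0
        nlinarith) (0, -1)
  refine ⟨fun x => (y x).1, fun x => (y x).2, by fun_prop, by fun_prop, fun x hx => ?_,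
    fun x hx => ?_, by simp [hy], by simp [hy]⟩
  · exact (hasFDerivAt_fst (𝕜 := ℝ) (p := y x)).comp_hasDerivAt x (hd x hx)
  · exact (hasFDerivAt_snd (𝕜 := ℝ) (p := y x)).comp_hasDerivAt x (hd x hx)

/-- Grönwall for the pair (D, D'). The source r enters only through its integral; this makes the
later perturbation bound an L¹ bound. -/
theorem norm_add_norm_deriv_le {D D' F : ℝ → ℂ} {r : ℝ → ℝ} {ℓ M c : ℝ} (hM : 0 ≤ M)
    (hDc : Continuous D) (hDc' : Continuous D') (hFc : Continuous F) (hr : Continuous r)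
    (hr0 : ∀ x, 0 ≤ r x)
    (hD : ∀ x ∈ Icc 0 ℓ, HasDerivAt D (D' x) x) (hD' : ∀ x ∈ Icc 0 ℓ, HasDerivAt D' (F x) x)
    (h0 : D ℓ = 0) (hc : ‖D' ℓ‖ ≤ c) (hF : ∀ x ∈ Icc 0 ℓ, ‖F x‖ ≤ M * ‖D x‖ + r x) :
    ∀ x ∈ Icc 0 ℓ, ‖D x‖ + ‖D' x‖ ≤ (c + ∫ t in 0..ℓ, r t) * Real.exp ((1 + M) * (ℓ - x)) := by
  refine le_mul_exp_of_le_add_mul_integral (by positivity) (by fun_prop) fun x hx => ?_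
  have hsub : Icc x ℓ ⊆ Icc 0 ℓ := Icc_subset_Icc hx.1 le_rfl
  have e1 : ∫ t in x..ℓ, D' t = D ℓ - D x :=
    intervalIntegral.integral_eq_sub_of_hasDerivAt
      (fun t ht => hD t (hsub (by rwa [uIcc_of_le hx.2] at ht))) (hDc'.intervalIntegrable _ _)
  have e2 : ∫ t in x..ℓ, F t = D' ℓ - D' x :=
    intervalIntegral.integral_eq_sub_of_hasDerivAt
      (fun t ht => hD' t (hsub (by rwa [uIcc_of_le hx.2] at ht))) (hFc.intervalIntegrable _ _)
  have b1 : ‖D x‖ ≤ ∫ t in x..ℓ, ‖D' t‖ := by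
    have : D x = -∫ t in x..ℓ, D' t := by rw [e1, h0]; ring
    rw [this, norm_neg]
    exact intervalIntegral.norm_integral_le_integral_norm hx.2
  have b2 : ‖D' x‖ ≤ c + ∫ t in x..ℓ, (M * ‖D t‖ + r t) := by
    have : D' x = D' ℓ - ∫ t in x..ℓ, F t := by rw [e2]; ring
    rw [this]
    refine (norm_sub_le _ _).trans (_root_.add_le_add hc ?_)
    exact intervalIntegral.norm_integral_le_of_norm_le hx.2
      (Filter.Eventually.of_forall fun t ht => hF t (hsub (Ioc_subset_Icc_self ht)))
      (Continuous.intervalIntegrable (by fun_prop) _ _)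
  have b3 : ∫ t in x..ℓ, (M * ‖D t‖ + r t) = (∫ t in x..ℓ, M * ‖D t‖) + ∫ t in x..ℓ, r t :=
    intervalIntegral.integral_add (Continuous.intervalIntegrable (by fun_prop) _ _)
      (Continuous.intervalIntegrable (by fun_prop) _ _)
  have b4 : ∫ t in x..ℓ, r t ≤ ∫ t in 0..ℓ, r t := by
    rw [← intervalIntegral.integral_add_adjacent_intervals (hr.intervalIntegrable 0 x)
      (hr.intervalIntegrable x ℓ)]
    have := intervalIntegral.integral_nonneg hx.1 (fun t _ => hr0 t) (μ := MeasureTheory.volume)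
    linarith
  have b5 : (∫ t in x..ℓ, ‖D' t‖) + (∫ t in x..ℓ, M * ‖D t‖) ≤
      (1 + M) * ∫ t in x..ℓ, (‖D t‖ + ‖D' t‖) := by
    rw [← intervalIntegral.integral_add (Continuous.intervalIntegrable (by fun_prop) _ _)
      (Continuous.intervalIntegrable (by fun_prop) _ _), ← intervalIntegral.integral_const_mul]
    refine intervalIntegral.integral_mono_on hx.2 (Continuous.intervalIntegrable (by fun_prop) _ _)
      (Continuous.intervalIntegrable (by fun_prop) _ _) fun t _ => ?_
    nlinarith [norm_nonneg (D t), norm_nonneg (D' t), mul_nonneg hM (norm_nonneg (D' t))]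
  linarith

namespace IsTerminalSolution

variable {Q Q₁ Q₂ φ ψ φ₁ ψ₁ φ₂ ψ₂ : ℝ → ℂ} {ℓ M : ℝ}

theorem norm_add_norm_le (h : IsTerminalSolution Q ℓ φ ψ) (hℓ : 0 ≤ ℓ) (hQ : Continuous Q)
    (hM : ∀ x ∈ Icc 0 ℓ, ‖Q x‖ ≤ M) :
    ∀ x ∈ Icc 0 ℓ, ‖φ x‖ + ‖ψ x‖ ≤ Real.exp ((1 + M) * ℓ) := by
  intro x hx
  have hM0 : 0 ≤ M := (norm_nonneg _).trans (hM 0 ⟨le_rfl, hℓ⟩)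
  have := norm_add_norm_deriv_le (r := fun _ => 0) (c := 1) hM0 h.continuous_fst
    h.continuous_snd (hQ.mul h.continuous_fst) continuous_const (fun _ => le_rfl)
    h.hasDerivAt_fst h.hasDerivAt_snd h.fst_end (by simp [h.snd_end]) (fun t ht => by
      rw [Pi.mul_apply, norm_mul, add_zero]
      exact mul_le_mul_of_nonneg_right (hM t ht) (norm_nonneg _)) x hx
  refine this.trans ?_
  rw [intervalIntegral.integral_zero, add_zero, one_mul, Real.exp_le_exp]
  exact mul_le_mul_of_nonneg_left (by linarith [hx.1]) (by positivity)

/-- The L¹ distance of the coefficients is essential: as ε → 0 the potentials converge in L¹ but not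
uniformly, since at s = 0 the value is 0 for ε ≠ 0 and a/(1 + a) for ε = 0. -/
theorem norm_sub_add_norm_sub_le (h₁ : IsTerminalSolution Q₁ ℓ φ₁ ψ₁)
    (h₂ : IsTerminalSolution Q₂ ℓ φ₂ ψ₂) (hℓ : 0 ≤ ℓ) (hQ₁ : Continuous Q₁) (hQ₂ : Continuous Q₂)
    (hM₁ : ∀ x ∈ Icc 0 ℓ, ‖Q₁ x‖ ≤ M) (hM₂ : ∀ x ∈ Icc 0 ℓ, ‖Q₂ x‖ ≤ M) :
    ∀ x ∈ Icc 0 ℓ, ‖φ₁ x - φ₂ x‖ + ‖ψ₁ x - ψ₂ x‖ ≤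
      Real.exp ((1 + M) * ℓ) ^ 2 * ∫ t in 0..ℓ, ‖Q₁ t - Q₂ t‖ := by
  intro x hx
  have hM0 : 0 ≤ M := (norm_nonneg _).trans (hM₁ 0 ⟨le_rfl, hℓ⟩)
  have hB := h₂.norm_add_norm_le hℓ hQ₂ hM₂
  have := norm_add_norm_deriv_le (D := fun x => φ₁ x - φ₂ x) (D' := fun x => ψ₁ x - ψ₂ x)
    (F := fun x => Q₁ x * φ₁ x - Q₂ x * φ₂ x)
    (r := fun x => Real.exp ((1 + M) * ℓ) * ‖Q₁ x - Q₂ x‖) (c := 0) hM0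
    (h₁.continuous_fst.sub h₂.continuous_fst) (h₁.continuous_snd.sub h₂.continuous_snd)
    ((hQ₁.mul h₁.continuous_fst).sub (hQ₂.mul h₂.continuous_fst)) (by fun_prop)
    (fun _ => by positivity)
    (fun x hx => (h₁.hasDerivAt_fst x hx).sub (h₂.hasDerivAt_fst x hx))
    (fun x hx => (h₁.hasDerivAt_snd x hx).sub (h₂.hasDerivAt_snd x hx))
    (by simp [h₁.fst_end, h₂.fst_end]) (by simp [h₁.snd_end, h₂.snd_end]) (fun t ht => by
      have e : Q₁ t * φ₁ t - Q₂ t * φ₂ t = Q₁ t * (φ₁ t - φ₂ t) + (Q₁ t - Q₂ t) * φ₂ t := by ring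
      rw [e]
      refine (norm_add_le _ _).trans (_root_.add_le_add ?_ ?_)
      · rw [norm_mul]
        exact mul_le_mul_of_nonneg_right (hM₁ t ht) (norm_nonneg _)
      · rw [norm_mul, mul_comm]
        refine mul_le_mul_of_nonneg_right ?_ (norm_nonneg _)
        linarith [hB t ht, norm_nonneg (ψ₂ t)]) x hx
  refine this.trans ?_
  rw [intervalIntegral.integral_const_mul, zero_add, sq, mul_right_comm]
  refine mul_le_mul_of_nonneg_right (mul_le_mul_of_nonneg_left ?_ (Real.exp_pos _).le) ?_
  · rw [Real.exp_le_exp]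
    exact mul_le_mul_of_nonneg_left (by linarith [hx.1]) (by positivity)
  · exact intervalIntegral.integral_nonneg hℓ fun _ _ => norm_nonneg _

theorem eqOn (h₁ : IsTerminalSolution Q ℓ φ₁ ψ₁)
    (h₂ : IsTerminalSolution Q ℓ φ₂ ψ₂) (hℓ : 0 ≤ ℓ) (hQ : Continuous Q)
    (hM : ∀ x ∈ Icc 0 ℓ, ‖Q x‖ ≤ M) :
    ∀ x ∈ Icc 0 ℓ, φ₁ x = φ₂ x ∧ ψ₁ x = ψ₂ x := by
  intro x hx
  have := h₁.norm_sub_add_norm_sub_le h₂ hℓ hQ hQ hM hM x hx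
  simp only [sub_self, norm_zero, intervalIntegral.integral_zero, mul_zero] at this
  have h3 := norm_nonneg (φ₁ x - φ₂ x)
  have h4 := norm_nonneg (ψ₁ x - ψ₂ x)
  exact ⟨sub_eq_zero.1 (norm_eq_zero.1 (by linarith)), sub_eq_zero.1 (norm_eq_zero.1 (by linarith))⟩

end IsTerminalSolution

theorem HasDerivAt.conj_comp {f : ℝ → ℂ} {f' : ℂ} {x : ℝ} (h : HasDerivAt f f' x) :
    HasDerivAt (fun t => starRingEnd ℂ (f t)) (starRingEnd ℂ f') x :=
  Complex.conjCLE.toContinuousLinearMap.hasFDerivAt.comp_hasDerivAt x h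

theorem IsTerminalSolution.im_eq_zero {Q φ ψ : ℝ → ℂ} {ℓ M : ℝ}
    (h : IsTerminalSolution Q ℓ φ ψ) (hℓ : 0 ≤ ℓ) (hQ : Continuous Q)
    (hM : ∀ x ∈ Icc 0 ℓ, ‖Q x‖ ≤ M) (hre : ∀ x, (Q x).im = 0) :
    ∀ x ∈ Icc 0 ℓ, (φ x).im = 0 ∧ (ψ x).im = 0 := by
  have hc : IsTerminalSolution Q ℓ (fun x => starRingEnd ℂ (φ x)) (fun x => starRingEnd ℂ (ψ x)) :=
    { continuous_fst := Complex.continuous_conj.comp h.continuous_fst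
      continuous_snd := Complex.continuous_conj.comp h.continuous_snd
      hasDerivAt_fst := fun x hx => (h.hasDerivAt_fst x hx).conj_comp
      hasDerivAt_snd := fun x hx => by
        have := (h.hasDerivAt_snd x hx).conj_comp
        rwa [map_mul, Complex.conj_eq_iff_im.2 (hre x)] at this
      fst_end := by simp [h.fst_end]
      snd_end := by simp [h.snd_end] }
  intro x hx
  have := hc.eqOn h hℓ hQ hM x hx
  exact ⟨Complex.conj_eq_iff_im.1 this.1, Complex.conj_eq_iff_im.1 this.2⟩

/-! ### Reflection, gluing and regularity. -/

theorem hasDerivAt_ite_nonneg {f g f' g' : ℝ → ℂ} {ℓ : ℝ}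
    (hf : ∀ x ∈ Icc 0 ℓ, HasDerivAt f (f' x) x) (hg : ∀ x ∈ Icc (-ℓ) 0, HasDerivAt g (g' x) x)
    (h0 : f 0 = g 0) (h0' : f' 0 = g' 0) :
    ∀ x ∈ Icc (-ℓ) ℓ, HasDerivAt (fun x => if 0 ≤ x then f x else g x)
      (if 0 ≤ x then f' x else g' x) x := by
  intro x hx
  rcases lt_trichotomy x 0 with h | rfl | h
  · rw [if_neg (not_le.2 h)]
    refine (hg x ⟨hx.1, h.le⟩).congr_of_eventuallyEq ?_
    filter_upwards [Iio_mem_nhds h] with y hy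
    rw [if_neg (not_le.2 hy)]
  · rw [if_pos le_rfl]
    have hℓ : 0 ≤ ℓ := hx.2
    have h1 : HasDerivWithinAt (fun x => if 0 ≤ x then f x else g x) (f' 0) (Ici 0) 0 :=
      (hf 0 ⟨le_rfl, hℓ⟩).hasDerivWithinAt.congr (fun y hy => if_pos hy) (if_pos le_rfl)
    have h2 : HasDerivWithinAt (fun x => if 0 ≤ x then f x else g x) (f' 0) (Iic 0) 0 := by
      rw [h0']
      refine (hg 0 ⟨by linarith, le_rfl⟩).hasDerivWithinAt.congr (fun y hy => ?_) ?_
      · rcases eq_or_lt_of_le (mem_Iic.1 hy) with rfl | h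
        · rw [if_pos le_rfl, h0]
        · rw [if_neg (not_le.2 h)]
      · rw [if_pos le_rfl, h0]
    have := h1.union h2
    rwa [Ici_union_Iic, hasDerivWithinAt_univ] at this
  · rw [if_pos h.le]
    refine (hf x ⟨h.le, hx.2⟩).congr_of_eventuallyEq ?_
    filter_upwards [Ioi_mem_nhds h] with y hy
    rw [if_pos (le_of_lt hy)]

/-- The conjugate reflection of φ/φ(0) solves the same equation on [−ℓ, 0] and also equals 1 at 0.
The derivatives match there exactly when ψ(0)/φ(0) is minus its own conjugate, that is, purely
imaginary. -/
theorem IsTerminalSolution.exists_symmetric_extension {Q φ ψ : ℝ → ℂ} {ℓ : ℝ}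
    (h : IsTerminalSolution Q ℓ φ ψ) (hℓ : 0 < ℓ) (hQ : ∀ x, Q (-x) = starRingEnd ℂ (Q x))
    (h0 : φ 0 ≠ 0) (hre : (ψ 0 / φ 0).re = 0) :
    ∃ Φ Ψ : ℝ → ℂ, (∀ x ∈ Icc (-ℓ) ℓ, HasDerivAt Φ (Ψ x) x) ∧
      (∀ x ∈ Icc (-ℓ) ℓ, HasDerivAt Ψ (Q x * Φ x) x) ∧ Φ (-ℓ) = 0 ∧ Φ ℓ = 0 ∧ Φ 0 = 1 := by
  have hneg : ∀ {x}, x ∈ Icc (-ℓ) 0 → -x ∈ Icc 0 ℓ := fun hx => ⟨by linarith [hx.2], by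
    linarith [hx.1]⟩
  have hconj : ψ 0 / φ 0 = -starRingEnd ℂ (ψ 0 / φ 0) := by
    generalize ψ 0 / φ 0 = z at hre
    apply Complex.ext <;> simp [hre]
  refine ⟨fun x => if 0 ≤ x then φ x / φ 0 else starRingEnd ℂ (φ (-x) / φ 0),
    fun x => if 0 ≤ x then ψ x / φ 0 else -starRingEnd ℂ (ψ (-x) / φ 0), ?_, ?_, ?_, ?_, ?_⟩
  · refine hasDerivAt_ite_nonneg (f' := fun x => ψ x / φ 0)
      (g' := fun x => -starRingEnd ℂ (ψ (-x) / φ 0)) (fun x hx => ?_) (fun x hx => ?_) ?_ ?_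
    · exact (h.hasDerivAt_fst x hx).div_const _
    · have h1 := ((h.hasDerivAt_fst (-x) (hneg hx)).div_const (φ 0)).scomp x (hasDerivAt_neg x)
      have h2 := h1.conj_comp
      simpa using h2
    · simp [h0]
    · simpa only [neg_zero] using hconj
  · have key := hasDerivAt_ite_nonneg (ℓ := ℓ) (f := fun x => ψ x / φ 0)
      (g := fun x => -starRingEnd ℂ (ψ (-x) / φ 0)) (f' := fun x => Q x * φ x / φ 0)
      (g' := fun x => Q x * starRingEnd ℂ (φ (-x) / φ 0)) (fun x hx => ?_) (fun x hx => ?_) ?_ ?_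
    · intro x hx
      refine (key x hx).congr_deriv ?_
      dsimp only
      split_ifs <;> ring
    · exact (h.hasDerivAt_snd x hx).div_const _
    · have h1 := ((h.hasDerivAt_snd (-x) (hneg hx)).div_const (φ 0)).scomp x (hasDerivAt_neg x)
      have h2 := h1.conj_comp.neg
      refine h2.congr_deriv ?_
      simp [hQ]
      ring
    · simpa only [neg_zero] using hconj
    · simp [h0]
  · simp [hℓ, h.fst_end]
  · simp [hℓ.le, h.fst_end]
  · simp [h0]

/-- Bootstrap. Allowing any set of unique differentiability covers both the open interval and [0,
1], where smoothness up to the walls is needed. -/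
theorem contDiffOn_of_second_order {S : Set ℝ} (hS : UniqueDiffOn ℝ S) {Q φ ψ : ℝ → ℂ}
    (hQ : ContDiffOn ℝ (⊤ : ℕ∞) Q S) (h₁ : ∀ x ∈ S, HasDerivWithinAt φ (ψ x) S x)
    (h₂ : ∀ x ∈ S, HasDerivWithinAt ψ (Q x * φ x) S x) :
    ContDiffOn ℝ (⊤ : ℕ∞) φ S ∧ ContDiffOn ℝ (⊤ : ℕ∞) ψ S := by
  have key : ∀ n : ℕ, ContDiffOn ℝ n φ S ∧ ContDiffOn ℝ n ψ S := by
    intro n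
    induction n with
    | zero =>
      simp only [Nat.cast_zero, contDiffOn_zero]
      exact ⟨fun x hx => (h₁ x hx).continuousWithinAt, fun x hx => (h₂ x hx).continuousWithinAt⟩
    | succ n ih =>
      have hQn : ContDiffOn ℝ n Q S := hQ.of_le (by exact_mod_cast le_top)
      push_cast
      constructor
      · rw [contDiffOn_succ_iff_derivWithin hS]
        exact ⟨fun x hx => (h₁ x hx).differentiableWithinAt, by simp,
          ih.2.congr fun x hx => (h₁ x hx).derivWithin (hS x hx)⟩
      · rw [contDiffOn_succ_iff_derivWithin hS]
        exact ⟨fun x hx => (h₂ x hx).differentiableWithinAt, by simp,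
          (hQn.mul ih.1).congr fun x hx => (h₂ x hx).derivWithin (hS x hx)⟩
  exact ⟨contDiffOn_infty.2 fun n => (key n).1, contDiffOn_infty.2 fun n => (key n).2⟩

/-! ### The scaled shear and its Rayleigh potential. -/

noncomputable section

/-- The scaled shear, centred at its critical level. -/
def centredShear (a s : ℝ) : ℝ := s + a * Real.sin s

/-- The scaled potential of the Rayleigh equation, minus the second derivative of the shear divided
by the shear minus `iε`; for `ε = 0` its continuous extension. -/
def rayleighPotential (a ε s : ℝ) : ℂ :=
  if ε = 0 then ((a * Real.sinc s / (1 + a * Real.sinc s) : ℝ) : ℂ)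
  else (a * Real.sin s : ℝ) / ((centredShear a s : ℂ) - ε * Complex.I)

end

theorem Real.mul_sinc (s : ℝ) : s * Real.sinc s = Real.sin s := by
  rcases eq_or_ne s 0 with rfl | h
  · simp
  · rw [Real.sinc_of_ne_zero h, mul_div_cancel₀ _ h]

variable {a : ℝ}

theorem centredShear_eq_mul (a s : ℝ) : centredShear a s = s * (1 + a * Real.sinc s) := by
  rw [centredShear, ← Real.mul_sinc]; ring

@[fun_prop]
theorem continuous_centredShear (a : ℝ) : Continuous (centredShear a) := by
  unfold centredShear; fun_prop

theorem one_sub_le_one_add_mul_sinc (ha : 0 < a) (s : ℝ) : 1 - a ≤ 1 + a * Real.sinc s := by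
  nlinarith [Real.neg_one_le_sinc s]

theorem centredShear_neg (a s : ℝ) : centredShear a (-s) = -centredShear a s := by
  simp [centredShear]; ring

theorem mul_abs_le_abs_centredShear (ha : 0 < a) (ha1 : a < 1) (s : ℝ) :
    (1 - a) * |s| ≤ |centredShear a s| := by
  have := one_sub_le_one_add_mul_sinc ha s
  rw [centredShear_eq_mul, abs_mul, abs_of_pos (by linarith : 0 < 1 + a * Real.sinc s), mul_comm]
  exact mul_le_mul_of_nonneg_left this (abs_nonneg s)

theorem mul_le_centredShear (ha : 0 < a) {s : ℝ} (hs : 0 ≤ s) :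
    (1 - a) * s ≤ centredShear a s := by
  rw [centredShear_eq_mul, mul_comm]
  exact mul_le_mul_of_nonneg_left (one_sub_le_one_add_mul_sinc ha s) hs

theorem centredShear_pos (ha : 0 < a) (ha1 : a < 1) {s : ℝ} (hs : 0 < s) :
    0 < centredShear a s :=
  (mul_pos (sub_pos.2 ha1) hs).trans_le (mul_le_centredShear ha hs.le)

theorem centredShear_le (ha : 0 < a) (ha1 : a < 1) {s : ℝ} (hs : 0 ≤ s) :
    centredShear a s ≤ 2 * s := by
  have := Real.sin_le hs
  unfold centredShear
  nlinarith

theorem hasDerivAt_centredShear (a s : ℝ) :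
    HasDerivAt (centredShear a) (1 + a * Real.cos s) s :=
  (hasDerivAt_id s).add ((Real.hasDerivAt_sin s).const_mul a)

theorem sub_mul_I_ne_zero {x ε : ℝ} (h : x ≠ 0 ∨ ε ≠ 0) : (x : ℂ) - ε * Complex.I ≠ 0 := by
  intro h0
  have h1 := congrArg Complex.re h0
  have h2 := congrArg Complex.im h0
  simp at h1 h2
  tauto

theorem abs_le_norm_sub_mul_I (x ε : ℝ) : |x| ≤ ‖(x : ℂ) - ε * Complex.I‖ := by
  have := Complex.abs_re_le_norm ((x : ℂ) - ε * Complex.I)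
  simpa using this

theorem centredShear_ne_zero (ha : 0 < a) (ha1 : a < 1) {s : ℝ} (hs : s ≠ 0) :
    centredShear a s ≠ 0 := by
  intro h
  have := mul_abs_le_abs_centredShear ha ha1 s
  rw [h, abs_zero] at this
  have := mul_pos (sub_pos.2 ha1) (abs_pos.2 hs)
  linarith

theorem rayleighPotential_of_ne_zero (a ε : ℝ) {s : ℝ} (hs : s ≠ 0) :
    rayleighPotential a ε s =
      (a * Real.sin s : ℝ) / ((centredShear a s : ℂ) - ε * Complex.I) := by
  unfold rayleighPotential
  split_ifs with h
  · rw [h, centredShear_eq_mul, ← Real.mul_sinc]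
    have hs' : (s : ℂ) ≠ 0 := by exact_mod_cast hs
    push_cast
    rw [zero_mul, sub_zero, mul_left_comm, mul_div_mul_left _ _ hs']
  · rfl

theorem continuous_rayleighPotential (ha : 0 < a) (ha1 : a < 1) (ε : ℝ) :
    Continuous (rayleighPotential a ε) := by
  unfold rayleighPotential
  split_ifs with h
  · refine Complex.continuous_ofReal.comp (Continuous.div ?_ ?_ fun s => ?_)
    · exact Real.continuous_sinc.const_mul a
    · exact (Real.continuous_sinc.const_mul a).const_add 1
    · have := one_sub_le_one_add_mul_sinc ha s
      linarith
  · exact Continuous.div (by fun_prop) (by fun_prop) fun s => sub_mul_I_ne_zero (Or.inr h)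

/-- Uniform in ε: the denominator is at least |f| ≥ (1 − a)|s| in modulus, and |sin s| ≤ |s|. The
point s = 0 follows by density and continuity. -/
theorem norm_rayleighPotential_le (ha : 0 < a) (ha1 : a < 1) (ε s : ℝ) :
    ‖rayleighPotential a ε s‖ ≤ a / (1 - a) := by
  have h1 : 0 < 1 - a := sub_pos.2 ha1
  have key : ∀ s, s ≠ 0 → ‖rayleighPotential a ε s‖ ≤ a / (1 - a) := by
    intro s hs
    rw [rayleighPotential_of_ne_zero a ε hs, norm_div, Complex.norm_real, Real.norm_eq_abs,
      abs_mul, abs_of_pos ha]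
    have h2 := (mul_abs_le_abs_centredShear ha ha1 s).trans
      (abs_le_norm_sub_mul_I (centredShear a s) ε)
    have h3 : 0 < (1 - a) * |s| := mul_pos h1 (abs_pos.2 hs)
    rw [div_le_div_iff₀ (h3.trans_le h2) h1]
    have h4 : |Real.sin s| ≤ |s| := Real.abs_sin_le_abs
    calc a * |Real.sin s| * (1 - a) ≤ a * |s| * (1 - a) := by gcongr
      _ = a * ((1 - a) * |s|) := by ring
      _ ≤ _ := by gcongr
  have hcl : IsClosed {s | ‖rayleighPotential a ε s‖ ≤ a / (1 - a)} :=
    isClosed_le (continuous_rayleighPotential ha ha1 ε).norm continuous_const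
  have hd : Dense {s | ‖rayleighPotential a ε s‖ ≤ a / (1 - a)} :=
    (dense_compl_singleton (0 : ℝ)).mono fun s hs => key s hs
  have := hd s
  rwa [hcl.closure_eq] at this

theorem rayleighPotential_neg (a ε s : ℝ) :
    rayleighPotential a ε (-s) = starRingEnd ℂ (rayleighPotential a ε s) := by
  unfold rayleighPotential
  split_ifs with h
  · simp
  · rw [centredShear_neg, map_div₀]
    simp only [Real.sin_neg, map_sub, map_mul, Complex.conj_ofReal, Complex.conj_I]
    push_cast
    rw [← neg_div_neg_eq]
    ring_nf

theorem contDiff_rayleighPotential {ε : ℝ} (a : ℝ) (hε : ε ≠ 0) :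
    ContDiff ℝ (⊤ : ℕ∞) (rayleighPotential a ε) := by
  unfold rayleighPotential centredShear
  simp only [if_neg hε]
  have h1 : ContDiff ℝ (⊤ : ℕ∞) fun s : ℝ => ((a * Real.sin s : ℝ) : ℂ) :=
    Complex.ofRealCLM.contDiff.comp (contDiff_const.mul Real.contDiff_sin)
  have h2 : ContDiff ℝ (⊤ : ℕ∞) fun s : ℝ => ((s + a * Real.sin s : ℝ) : ℂ) :=
    Complex.ofRealCLM.contDiff.comp (contDiff_id.add (contDiff_const.mul Real.contDiff_sin))
  simp only [div_eq_mul_inv]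
  exact h1.mul ((h2.sub contDiff_const).inv fun s => sub_mul_I_ne_zero (Or.inr hε))

-- Dominated convergence; pointwise convergence can fail only at t = 0, a null set.
open MeasureTheory Filter Topology in
theorem tendsto_integral_norm_rayleighPotential_sub (ha : 0 < a) (ha1 : a < 1) (ℓ ε₀ : ℝ) :
    Tendsto (fun ε => ∫ t in 0..ℓ, ‖rayleighPotential a ε t - rayleighPotential a ε₀ t‖)
      (𝓝 ε₀) (𝓝 0) := by
  suffices key : Tendsto (fun ε => ∫ t in 0..ℓ, ‖rayleighPotential a ε t - rayleighPotential a ε₀ t‖)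
      (𝓝 ε₀) (𝓝 (∫ t in 0..ℓ, ‖rayleighPotential a ε₀ t - rayleighPotential a ε₀ t‖)) by
    simpa only [sub_self, norm_zero, intervalIntegral.integral_zero] using key
  refine intervalIntegral.tendsto_integral_filter_of_dominated_convergence
    (fun _ => a / (1 - a) + a / (1 - a)) ?_ ?_ ?_ ?_
  · exact Eventually.of_forall fun ε => ((continuous_rayleighPotential ha ha1 ε).sub
      (continuous_rayleighPotential ha ha1 ε₀)).norm.aestronglyMeasurable
  · refine Eventually.of_forall fun ε => Eventually.of_forall fun t _ => ?_
    rw [norm_norm]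
    exact (norm_sub_le _ _).trans (_root_.add_le_add (norm_rayleighPotential_le ha ha1 ε t)
      (norm_rayleighPotential_le ha ha1 ε₀ t))
  · exact _root_.intervalIntegrable_const
  · have hne : ∀ᵐ t : ℝ, t ≠ 0 := by simp [ae_iff]
    filter_upwards [hne] with t ht _
    have : ContinuousAt (fun ε : ℝ => rayleighPotential a ε t) ε₀ := by
      simp only [rayleighPotential_of_ne_zero a _ ht]
      refine ContinuousAt.div continuousAt_const (by fun_prop) ?_
      exact sub_mul_I_ne_zero (Or.inl (centredShear_ne_zero ha ha1 ht))
    exact (this.tendsto.sub_const _).norm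

/-! ### The neutral problem ε = 0: positivity and the sign of the slope at 0. -/

/-- `u`, with derivative `w`, is the real solution of the scaled Rayleigh equation at the inflection
value, with terminal data `u ℓ = 0` and `w ℓ = -1`. -/
structure IsNeutralSolution (a μ ℓ : ℝ) (u w : ℝ → ℝ) : Prop where
  hasDerivAt_fst : ∀ x ∈ Icc 0 ℓ, HasDerivAt u (w x) x
  hasDerivAt_snd : ∀ x ∈ Icc 0 ℓ, HasDerivAt w
    ((μ - a * Real.sinc x / (1 + a * Real.sinc x)) * u x) x
  fst_end : u ℓ = 0
  snd_end : w ℓ = -1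

theorem HasDerivAt.re_comp {f : ℝ → ℂ} {f' : ℂ} {x : ℝ} (h : HasDerivAt f f' x) :
    HasDerivAt (fun t => (f t).re) f'.re x :=
  Complex.reCLM.hasFDerivAt.comp_hasDerivAt x h

theorem HasDerivAt.im_comp {f : ℝ → ℂ} {f' : ℂ} {x : ℝ} (h : HasDerivAt f f' x) :
    HasDerivAt (fun t => (f t).im) f'.im x :=
  Complex.imCLM.hasFDerivAt.comp_hasDerivAt x h

theorem rayleighPotential_zero (a s : ℝ) :
    rayleighPotential a 0 s = ((a * Real.sinc s / (1 + a * Real.sinc s) : ℝ) : ℂ) := if_pos rfl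

theorem IsTerminalSolution.isNeutralSolution {μ ℓ : ℝ} {φ ψ : ℝ → ℂ}
    (h : IsTerminalSolution (fun s => μ - rayleighPotential a 0 s) ℓ φ ψ) :
    IsNeutralSolution a μ ℓ (fun x => (φ x).re) (fun x => (ψ x).re) where
  hasDerivAt_fst x hx := (h.hasDerivAt_fst x hx).re_comp
  hasDerivAt_snd x hx := by
    have := (h.hasDerivAt_snd x hx).re_comp
    rwa [rayleighPotential_zero, ← Complex.ofReal_sub, Complex.re_ofReal_mul] at this
  fst_end := by simp [h.fst_end]
  snd_end := by simp [h.snd_end]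

namespace IsNeutralSolution

variable {μ ℓ : ℝ} {u w : ℝ → ℝ}

/-- The shear f solves the equation for μ = 0 and is positive on (0, ℓ]. The Wronskian W = wf − uf'
satisfies W' = μuf and W(ℓ) < 0, while (u/f)' = W/f². Negativity of W and positivity of u therefore
propagate together down from ℓ. -/
theorem pos (h : IsNeutralSolution a μ ℓ u w) (ha : 0 < a) (ha1 : a < 1) (hℓ : 0 < ℓ)
    (hμ : 0 ≤ μ) : ∀ x ∈ Ico 0 ℓ, 0 < u x := by
  let f := centredShear a
  let W : ℝ → ℝ := fun x => w x * f x - u x * (1 + a * Real.cos x)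
  have hf : ∀ x, 0 < x → 0 < f x := fun x hx => centredShear_pos ha ha1 hx
  have hW : ∀ x ∈ Icc 0 ℓ, HasDerivAt W (μ * u x * f x) x := by
    intro x hx
    have h1 := ((h.hasDerivAt_snd x hx).mul (hasDerivAt_centredShear a x)).sub
      ((h.hasDerivAt_fst x hx).mul (((Real.hasDerivAt_cos x).const_mul a).const_add 1))
    refine h1.congr_deriv ?_
    have h2 := one_sub_le_one_add_mul_sinc ha x
    have h3 : 1 + a * Real.sinc x ≠ 0 := by linarith
    have h4 : a * Real.sinc x / (1 + a * Real.sinc x) * f x = a * Real.sin x := by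
      simp only [f]
      rw [centredShear_eq_mul, ← Real.mul_sinc]
      field_simp
    have : (μ - a * Real.sinc x / (1 + a * Real.sinc x)) * u x * centredShear a x =
      μ * u x * f x - (a * Real.sinc x / (1 + a * Real.sinc x) * f x) * u x := by
        simp only [f]; ring
    rw [this, h4]
    ring
  have hWc : ContinuousOn W (Icc 0 ℓ) := fun x hx => (hW x hx).continuousAt.continuousWithinAt
  have hWℓ : W ℓ < 0 := by
    simp only [W, h.fst_end, h.snd_end]
    have := hf ℓ hℓ
    linarith
  have hquot : ∀ x₁, 0 ≤ x₁ → (∀ x ∈ Ioo x₁ ℓ, W x < 0) → ∀ x ∈ Ioo x₁ ℓ, 0 < u x := by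
    intro x₁ hx₁ hneg x hx
    have hx0 : 0 < x := hx₁.trans_lt hx.1
    have hd : ∀ y ∈ Icc x ℓ, HasDerivAt (fun y => u y / f y)
        (W y / f y ^ 2) y := fun y hy =>
      (h.hasDerivAt_fst y ⟨hx0.le.trans hy.1, hy.2⟩).div (hasDerivAt_centredShear a y)
        (hf y (hx0.trans_le hy.1)).ne'
    have hanti : StrictAntiOn (fun y => u y / f y) (Icc x ℓ) := by
      refine strictAntiOn_of_deriv_neg (convex_Icc x ℓ)
        (fun y hy => (hd y hy).continuousAt.continuousWithinAt) fun y hy => ?_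
      rw [interior_Icc] at hy
      rw [(hd y (Ioo_subset_Icc_self hy)).deriv]
      exact div_neg_of_neg_of_pos (hneg y ⟨hx.1.trans hy.1, hy.2⟩)
        (pow_pos (hf y (hx0.trans hy.1)) 2)
    have := hanti ⟨le_rfl, hx.2.le⟩ ⟨hx.2.le, le_rfl⟩ hx.2
    simp only [h.fst_end, zero_div] at this
    exact (div_pos_iff_of_pos_right (hf x hx0)).1 this
  have hWneg : ∀ x ∈ Icc 0 ℓ, W x < 0 := by
    by_contra! hcon
    obtain ⟨x₀, hx₀, hWx₀⟩ := hcon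
    have hcomp : IsCompact (Icc 0 ℓ ∩ W ⁻¹' Ici 0) :=
      isCompact_Icc.of_isClosed_subset (hWc.preimage_isClosed_of_isClosed isClosed_Icc isClosed_Ici)
        inter_subset_left
    -- Let x₁ be the last point with W ≥ 0. To its right W < 0, so u > 0 and W is nondecreasing;
    -- hence W(x₁) ≤ W(ℓ) < 0, a contradiction.
    obtain ⟨x₁, ⟨hx₁, hWx₁⟩, hmax⟩ := hcomp.exists_isGreatest ⟨x₀, hx₀, hWx₀⟩
    have hneg : ∀ x ∈ Ioo x₁ ℓ, W x < 0 := fun x hx => by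
      by_contra! hge
      exact absurd (hmax ⟨⟨hx₁.1.trans hx.1.le, hx.2.le⟩, hge⟩) (not_le.2 hx.1)
    have hupos := hquot x₁ hx₁.1 hneg
    have hmono : MonotoneOn W (Icc x₁ ℓ) := by
      refine monotoneOn_of_deriv_nonneg (convex_Icc _ _)
        (hWc.mono (Icc_subset_Icc hx₁.1 le_rfl)) (fun y hy => ?_) fun y hy => ?_
      · rw [interior_Icc] at hy
        exact (hW y ⟨hx₁.1.trans hy.1.le, hy.2.le⟩).differentiableAt.differentiableWithinAt
      · rw [interior_Icc] at hy
        rw [(hW y ⟨hx₁.1.trans hy.1.le, hy.2.le⟩).deriv]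
        exact mul_nonneg (mul_nonneg hμ (hupos y hy).le) (hf y (hx₁.1.trans_lt hy.1)).le
    have := hmono ⟨le_rfl, hx₁.2⟩ ⟨hx₁.2, le_rfl⟩ hx₁.2
    exact absurd (mem_Ici.1 hWx₁) (not_le.2 (this.trans_lt hWℓ))
  intro x hx
  rcases hx.1.eq_or_lt with rfl | hx0
  -- The quotient u/f is unavailable at 0, but f(0) = 0 gives W(0) = −(1 + a)u(0).
  · have := hWneg 0 ⟨le_rfl, hℓ.le⟩
    simp only [W, f, centredShear, Real.sin_zero, Real.cos_zero] at this
    nlinarith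
  · exact hquot 0 le_rfl (fun y hy => hWneg y (Ioo_subset_Icc_self hy)) x ⟨hx0, hx.2⟩

theorem nonneg (h : IsNeutralSolution a μ ℓ u w) (ha : 0 < a) (ha1 : a < 1) (hℓ : 0 < ℓ)
    (hμ : 0 ≤ μ) {x : ℝ} (hx : x ∈ Icc 0 ℓ) : 0 ≤ u x := by
  rcases hx.2.eq_or_lt with rfl | hlt
  · exact h.fst_end.ge
  · exact (h.pos ha ha1 hℓ hμ x ⟨hx.1, hlt⟩).le

/-- For μ = 1 the coefficient is 1/(1 + a sinc) > 0, so u is convex and its slope is at most the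
terminal value −1. -/
theorem deriv_zero_neg_of_one (h : IsNeutralSolution a 1 ℓ u w) (ha : 0 < a) (ha1 : a < 1)
    (hℓ : 0 < ℓ) : w 0 < 0 := by
  have hmono : MonotoneOn w (Icc 0 ℓ) := by
    refine monotoneOn_of_deriv_nonneg (convex_Icc _ _)
      (fun y hy => (h.hasDerivAt_snd y hy).continuousAt.continuousWithinAt) (fun y hy => ?_)
      fun y hy => ?_
    · rw [interior_Icc] at hy
      exact (h.hasDerivAt_snd y (Ioo_subset_Icc_self hy)).differentiableAt.differentiableWithinAt
    · rw [interior_Icc] at hy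
      rw [(h.hasDerivAt_snd y (Ioo_subset_Icc_self hy)).deriv]
      refine mul_nonneg ?_ (h.nonneg ha ha1 hℓ zero_le_one (Ioo_subset_Icc_self hy))
      have h2 := one_sub_le_one_add_mul_sinc ha y
      rw [sub_nonneg, div_le_one (by linarith)]
      linarith
  have := hmono ⟨le_rfl, hℓ.le⟩ ⟨hℓ.le, le_rfl⟩ hℓ.le
  rw [h.snd_end] at this
  linarith

/-- Sturm comparison: the Wronskian w₀u − u₀w increases strictly to 0 at ℓ, so it is negative at 0,
where it equals −u₀w. -/
theorem deriv_zero_pos_of_lt {μ₀ : ℝ} {u₀ w₀ : ℝ → ℝ} (h : IsNeutralSolution a μ ℓ u w)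
    (h₀ : IsNeutralSolution a μ₀ ℓ u₀ w₀) (ha : 0 < a) (ha1 : a < 1) (hℓ : 0 < ℓ)
    (hμ : 0 ≤ μ) (hlt : μ < μ₀) (hw : w₀ 0 = 0) : 0 < w 0 := by
  let W : ℝ → ℝ := fun x => w₀ x * u x - u₀ x * w x
  have hW : ∀ x ∈ Icc 0 ℓ, HasDerivAt W ((μ₀ - μ) * (u₀ x * u x)) x := fun x hx =>
    (((h₀.hasDerivAt_snd x hx).mul (h.hasDerivAt_fst x hx)).sub
      ((h₀.hasDerivAt_fst x hx).mul (h.hasDerivAt_snd x hx))).congr_deriv (by ring)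
  have hpos := h.pos ha ha1 hℓ hμ
  have hpos₀ := h₀.pos ha ha1 hℓ (hμ.trans hlt.le)
  have hmono : StrictMonoOn W (Icc 0 ℓ) := by
    refine strictMonoOn_of_deriv_pos (convex_Icc _ _)
      (fun y hy => (hW y hy).continuousAt.continuousWithinAt) fun y hy => ?_
    rw [interior_Icc] at hy
    rw [(hW y (Ioo_subset_Icc_self hy)).deriv]
    exact mul_pos (sub_pos.2 hlt) (mul_pos (hpos₀ y (Ioo_subset_Ico_self hy))
      (hpos y (Ioo_subset_Ico_self hy)))
  have := hmono ⟨le_rfl, hℓ.le⟩ ⟨hℓ.le, le_rfl⟩ hℓ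
  simp only [W, hw, h.fst_end, h₀.fst_end] at this
  have h0 := hpos₀ 0 ⟨le_rfl, hℓ⟩
  by_contra! hle
  nlinarith

end IsNeutralSolution

theorem nonneg_of_hasDerivAt_nonneg {f f' : ℝ → ℝ} (h0 : f 0 = 0)
    (hd : ∀ x, HasDerivAt f (f' x) x) (hf' : ∀ x, 0 ≤ x → 0 ≤ f' x) {x : ℝ} (hx : 0 ≤ x) :
    0 ≤ f x := by
  rw [← h0]
  refine monotoneOn_of_deriv_nonneg (convex_Ici 0)
    (fun y _ => (hd y).continuousAt.continuousWithinAt)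
    (fun y _ => (hd y).differentiableAt.differentiableWithinAt) (fun y hy => ?_)
    (self_mem_Ici) (mem_Ici.2 hx) hx
  rw [interior_Ici] at hy
  rw [(hd y).deriv]
  exact hf' y (le_of_lt hy)

/-- Integrate repeatedly from 1 − x²/2 ≤ cos x, alternating between sine and cosine. -/
theorem Real.taylor_seven_le_sin {x : ℝ} (hx : 0 ≤ x) :
    x - x ^ 3 / 6 + x ^ 5 / 120 - x ^ 7 / 5040 ≤ Real.sin x := by
  have hp : ∀ (k : ℕ) (c x : ℝ), HasDerivAt (fun x : ℝ => x ^ k / c) (k * x ^ (k - 1) / c) x :=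
    fun k c x => (hasDerivAt_pow k x).div_const c
  have s3 : ∀ x : ℝ, 0 ≤ x → 0 ≤ Real.sin x - (x - x ^ 3 / 6) := fun x hx =>
    nonneg_of_hasDerivAt_nonneg (f := fun x => Real.sin x - (x - x ^ 3 / 6)) (by simp)
      (fun x => (Real.hasDerivAt_sin x).sub ((hasDerivAt_id x).sub (hp 3 6 x))) (fun x _ => by
        have := Real.one_sub_sq_div_two_le_cos (x := x)
        norm_num
        linarith) hx
  have c4 : ∀ x : ℝ, 0 ≤ x → 0 ≤ (1 - x ^ 2 / 2 + x ^ 4 / 24) - Real.cos x := fun x hx =>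
    nonneg_of_hasDerivAt_nonneg (f := fun x => (1 - x ^ 2 / 2 + x ^ 4 / 24) - Real.cos x) (by simp)
      (fun x => (((hp 2 2 x).const_sub 1).add (hp 4 24 x)).sub (Real.hasDerivAt_cos x))
      (fun x hx => by
        have := s3 x hx
        norm_num
        linarith) hx
  have s5 : ∀ x : ℝ, 0 ≤ x → 0 ≤ (x - x ^ 3 / 6 + x ^ 5 / 120) - Real.sin x := fun x hx =>
    nonneg_of_hasDerivAt_nonneg (f := fun x => (x - x ^ 3 / 6 + x ^ 5 / 120) - Real.sin x) (by simp)
      (fun x => (((hasDerivAt_id x).sub (hp 3 6 x)).add (hp 5 120 x)).sub (Real.hasDerivAt_sin x))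
      (fun x hx => by
        have := c4 x hx
        norm_num
        linarith) hx
  have c6 : ∀ x : ℝ, 0 ≤ x → 0 ≤ Real.cos x - (1 - x ^ 2 / 2 + x ^ 4 / 24 - x ^ 6 / 720) :=
    fun x hx =>
    nonneg_of_hasDerivAt_nonneg
      (f := fun x => Real.cos x - (1 - x ^ 2 / 2 + x ^ 4 / 24 - x ^ 6 / 720)) (by simp)
      (fun x => (Real.hasDerivAt_cos x).sub
        ((((hp 2 2 x).const_sub 1).add (hp 4 24 x)).sub (hp 6 720 x)))
      (fun x hx => by
        have := s5 x hx
        norm_num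
        linarith) hx
  have s7 := nonneg_of_hasDerivAt_nonneg
      (f := fun x => Real.sin x - (x - x ^ 3 / 6 + x ^ 5 / 120 - x ^ 7 / 5040)) (by simp)
      (fun x => (Real.hasDerivAt_sin x).sub
        ((((hasDerivAt_id x).sub (hp 3 6 x)).add (hp 5 120 x)).sub (hp 7 5040 x)))
      (fun x hx => by
        have := c6 x hx
        norm_num
        linarith) hx
  linarith

/-- With σ = sinc x ∈ [0, 1], aσ/(1 + aσ) increases in a, and at a = 1/2 it is σ/(2 + σ) ≥ σ/3. -/
theorem taylor_div_three_le_neutralPotential (ha : 1 / 2 < a) {x : ℝ} (hx : 0 ≤ x)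
    (hxπ : x ≤ Real.pi) :
    (1 - x ^ 2 / 6 + x ^ 4 / 120 - x ^ 6 / 5040) / 3 ≤
      a * Real.sinc x / (1 + a * Real.sinc x) := by
  have h1 : 1 - x ^ 2 / 6 + x ^ 4 / 120 - x ^ 6 / 5040 ≤ Real.sinc x := by
    rcases hx.eq_or_lt with rfl | hx0
    · simp
    · rw [Real.sinc_of_ne_zero hx0.ne', le_div_iff₀ hx0]
      have := Real.taylor_seven_le_sin hx
      linarith
  have h2 : 0 ≤ Real.sinc x := by
    rcases hx.eq_or_lt with rfl | hx0
    · simp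
    · rw [Real.sinc_of_ne_zero hx0.ne']
      exact div_nonneg (Real.sin_nonneg_of_nonneg_of_le_pi hx hxπ) hx
  have h3 := Real.sinc_le_one x
  refine (div_le_div_of_nonneg_right h1 (by norm_num)).trans ?_
  have h4 : 0 ≤ a * Real.sinc x := by positivity
  rw [div_le_div_iff₀ (by norm_num) (by linarith)]
  nlinarith [mul_nonneg h2 (by nlinarith : 0 ≤ 3 * a - 1 - a * Real.sinc x)]

/-- The Riccati variable q = w/u satisfies q' = μ − K − q². For a test function χ, (χ²q)' = χ'² +
χ²(μ − K) − (χ' − χq)². Take χ = 1 − βs², which vanishes at 31/10 < π, and integrate: −q(0) is at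
most the energy of χ, which is already negative for μ = 1/144 when K is replaced by its polynomial
lower bound. -/
theorem IsNeutralSolution.deriv_zero_pos {ℓ : ℝ} {u w : ℝ → ℝ}
    (h : IsNeutralSolution a (1 / 144) ℓ u w) (ha : 1 / 2 < a) (ha1 : a < 1)
    (hℓ : 31 / 10 < ℓ) : 0 < w 0 := by
  have ha0 : 0 < a := by linarith
  have hℓ0 : 0 < ℓ := by linarith
  have hpos := h.pos ha0 ha1 hℓ0 (by norm_num)
  -- β = (10/31)², so χ(31/10) = 0. H is the termwise antiderivative of the polynomial energy
  -- density H'.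
  let β : ℝ := 100 / 961
  let H : ℝ → ℝ := fun s => 4 * β ^ 2 * (s ^ 3 / 3)
    + 1 / 144 * (s - 2 * β * (s ^ 3 / 3) + β ^ 2 * (s ^ 5 / 5))
    - 1 / 3 * (s - (1 / 6 + 2 * β) * (s ^ 3 / 3) + (1 / 120 + β / 3 + β ^ 2) * (s ^ 5 / 5)
      - (1 / 5040 + β / 60 + β ^ 2 / 6) * (s ^ 7 / 7) + (β / 2520 + β ^ 2 / 120) * (s ^ 9 / 9)
      - β ^ 2 / 5040 * (s ^ 11 / 11))
  let H' : ℝ → ℝ := fun s => (-2 * β * s) ^ 2 + (1 - β * s ^ 2) ^ 2 *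
    (1 / 144 - (1 - s ^ 2 / 6 + s ^ 4 / 120 - s ^ 6 / 5040) / 3)
  have hp : ∀ (k : ℕ) (c x : ℝ), HasDerivAt (fun x : ℝ => x ^ k / c) (k * x ^ (k - 1) / c) x :=
    fun k c x => (hasDerivAt_pow k x).div_const c
  have hH : ∀ s, HasDerivAt H (H' s) s := fun s => by
    have := ((((hp 3 3 s).const_mul (4 * β ^ 2)).add
      ((((hasDerivAt_id s).sub ((hp 3 3 s).const_mul (2 * β))).add
        ((hp 5 5 s).const_mul (β ^ 2))).const_mul (1 / 144))).sub
      (((((((hasDerivAt_id s).sub ((hp 3 3 s).const_mul (1 / 6 + 2 * β))).add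
        ((hp 5 5 s).const_mul (1 / 120 + β / 3 + β ^ 2))).sub
        ((hp 7 7 s).const_mul (1 / 5040 + β / 60 + β ^ 2 / 6))).add
        ((hp 9 9 s).const_mul (β / 2520 + β ^ 2 / 120))).sub
        ((hp 11 11 s).const_mul (β ^ 2 / 5040))).const_mul (1 / 3)))
    refine this.congr_deriv ?_
    simp only [H']
    push_cast
    ring
  have hIcc : ∀ s ∈ Icc (0 : ℝ) (31 / 10), s ∈ Ico 0 ℓ := fun s hs =>
    ⟨hs.1, hs.2.trans_lt hℓ⟩
  let Z : ℝ → ℝ := fun s => (1 - β * s ^ 2) ^ 2 * (w s / u s) - H s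
  let K : ℝ → ℝ := fun s => a * Real.sinc s / (1 + a * Real.sinc s)
  have hZ : ∀ s ∈ Icc (0 : ℝ) (31 / 10), HasDerivAt Z
      (2 * (1 - β * s ^ 2) * (-2 * β * s) * (w s / u s)
        + (1 - β * s ^ 2) ^ 2 * (1 / 144 - K s - (w s / u s) ^ 2) - H' s) s := fun s hs => by
    have hs' := Ico_subset_Icc_self (hIcc s hs)
    have hu := (hpos s (hIcc s hs)).ne'
    have h1 := ((h.hasDerivAt_snd s hs').div (h.hasDerivAt_fst s hs') hu)
    have h2 : HasDerivAt (fun s : ℝ => (1 - β * s ^ 2) ^ 2)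
        (2 * (1 - β * s ^ 2) * (-2 * β * s)) s := by
      refine ((((hasDerivAt_pow 2 s).const_mul β).const_sub 1).pow 2).congr_deriv ?_
      push_cast
      ring
    refine ((h2.mul h1).sub (hH s)).congr_deriv ?_
    have h3 : (1 / 144 - a * Real.sinc s / (1 + a * Real.sinc s)) * u s * u s =
      (1 / 144 - K s) * u s ^ 2 := by simp only [K]; ring
    have h4 : ((1 / 144 - a * Real.sinc s / (1 + a * Real.sinc s)) * u s * u s - w s * w s)
        / u s ^ 2 = 1 / 144 - K s - (w s / u s) ^ 2 := by
      rw [h3]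
      field_simp
    simp only [Pi.div_apply]
    rw [h4]
  have hanti : AntitoneOn Z (Icc 0 (31 / 10)) := by
    refine antitoneOn_of_deriv_nonpos (convex_Icc _ _)
      (fun y hy => (hZ y hy).continuousAt.continuousWithinAt) (fun y hy => ?_) fun s hs => ?_
    · exact (hZ y (interior_subset hy)).differentiableAt.differentiableWithinAt
    · have hs' := interior_subset hs
      rw [(hZ s hs').deriv]
      have hK := taylor_div_three_le_neutralPotential ha hs'.1
        (hs'.2.trans (by have := Real.pi_gt_d2; norm_num at this ⊢; linarith))
      have h5 := mul_le_mul_of_nonneg_left hK (sq_nonneg (1 - β * s ^ 2))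
      have h6 := sq_nonneg (-2 * β * s - (1 - β * s ^ 2) * (w s / u s))
      simp only [H', K] at *
      nlinarith
  have hfin := hanti (left_mem_Icc.2 (by norm_num)) (right_mem_Icc.2 (by norm_num))
    (by norm_num : (0 : ℝ) ≤ 31 / 10)
  have hm : 0 < w 0 / u 0 := by
    simp only [Z, H, β] at hfin
    norm_num at hfin
    refine lt_of_lt_of_le ?_ hfin
    norm_num
  exact (div_pos_iff_of_pos_right (hpos 0 ⟨le_rfl, hℓ0⟩)).1 hm

/-! ### Monotonicity in ε near the neutral mode. -/

theorem re_div_sub_mul_I (S f e : ℝ) :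
    ((S : ℂ) / ((f : ℂ) - e * Complex.I)).re = S * f / (f ^ 2 + e ^ 2) := by
  simp [Complex.div_re, Complex.normSq_apply, sq]

theorem im_div_sub_mul_I (S f e : ℝ) :
    ((S : ℂ) / ((f : ℂ) - e * Complex.I)).im = S * e / (f ^ 2 + e ^ 2) := by
  simp [Complex.div_im, Complex.normSq_apply, sq, neg_div]

theorem re_rayleighPotential_sub_mul (ha : 0 < a) (ha1 : a < 1) {ε₁ ε₂ s : ℝ} (hs : 0 < s)
    (p : ℂ) :
    ((rayleighPotential a ε₁ s - rayleighPotential a ε₂ s) * p).re =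
      (ε₂ - ε₁) * (a * Real.sin s * (centredShear a s * (ε₁ + ε₂) * p.re
        + (centredShear a s ^ 2 - ε₁ * ε₂) * p.im) /
        ((centredShear a s ^ 2 + ε₁ ^ 2) * (centredShear a s ^ 2 + ε₂ ^ 2))) := by
  rw [rayleighPotential_of_ne_zero a _ hs.ne', rayleighPotential_of_ne_zero a _ hs.ne',
    Complex.mul_re, Complex.sub_re, Complex.sub_im, re_div_sub_mul_I, re_div_sub_mul_I,
    im_div_sub_mul_I, im_div_sub_mul_I]
  have hf := centredShear_pos ha ha1 hs
  field_simp
  ring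

/-- After removing the factor ε₂ − ε₁, the integrand splits into a part g₁ carrying Re p and a part
g₂ carrying Im p. The bound |Im p| ≤ ηs cancels the 1/s singularity of g₂. The part g₁ is
nonnegative up to x₀ and of size O(ε₂) beyond. On [ε₂, 2ε₂] it is at least 1/(2312ε₂), so this core
contributes 1/2312, which beats the total loss κℓ. -/
theorem integral_re_rayleighPotential_sub_mul_pos (ha : 1 / 2 < a) (ha1 : a < 1)
    {ε₁ ε₂ ℓ x₀ C η κ : ℝ} (hε₁ : 0 ≤ ε₁) (hε : ε₁ < ε₂) (hε₂ : 2 * ε₂ ≤ x₀) (hx₀ : x₀ ≤ 1)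
    (hℓ : 1 ≤ ℓ) (hC : 0 ≤ C) (hη : 0 ≤ η)
    (hκ : η / (1 - a) ^ 2 + 2 * ε₂ * C / ((1 - a) ^ 3 * x₀ ^ 2) ≤ κ) (hκℓ : κ * ℓ < 1 / 2312)
    {p : ℝ → ℂ} (hp : Continuous p) (hre : ∀ s ∈ Icc 0 ℓ, |(p s).re| ≤ C)
    (him : ∀ s ∈ Icc 0 ℓ, |(p s).im| ≤ η * s) (hnear : ∀ s ∈ Icc 0 x₀, 1 / 2 ≤ (p s).re) :
    0 < ∫ s in 0..ℓ, ((rayleighPotential a ε₁ s - rayleighPotential a ε₂ s) * p s).re := by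
  have ha0 : 0 < a := by linarith
  have h1a : 0 < 1 - a := by linarith
  have hε₂0 : 0 < ε₂ := by linarith
  have hx₀0 : 0 < x₀ := by linarith
  let f := centredShear a
  let D : ℝ → ℝ := fun s => (f s ^ 2 + ε₁ ^ 2) * (f s ^ 2 + ε₂ ^ 2)
  let g₁ : ℝ → ℝ := fun s => a * Real.sin s * (f s * (ε₁ + ε₂) * (p s).re) / D s
  let g₂ : ℝ → ℝ := fun s => a * Real.sin s * ((f s ^ 2 - ε₁ * ε₂) * (p s).im) / D s
  let N : ℝ → ℝ := fun s =>
    ((rayleighPotential a ε₁ s - rayleighPotential a ε₂ s) * p s).re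
  have hN : ∀ s, 0 < s → N s = (ε₂ - ε₁) * (g₁ s + g₂ s) := fun s hs => by
    simp only [N, g₁, g₂, D, f]
    rw [re_rayleighPotential_sub_mul ha0 ha1 hs]
    ring
  have hNc : Continuous N := by
    have h1 := continuous_rayleighPotential ha0 ha1 ε₁
    have h2 := continuous_rayleighPotential ha0 ha1 ε₂
    simp only [N]
    fun_prop
  have hf : ∀ s, 0 < s → 0 < f s := fun s hs => centredShear_pos ha0 ha1 hs
  have hfl : ∀ s, 0 < s → (1 - a) * s ≤ f s := fun s hs => mul_le_centredShear ha0 hs.le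
  have hD : ∀ s, 0 < s → 0 < D s := fun s hs => by
    have := hf s hs
    positivity
  have hsin : ∀ s, 0 < s → |a * Real.sin s| ≤ s := fun s hs => by
    rw [abs_mul, abs_of_pos ha0]
    have h1 : |Real.sin s| ≤ |s| := Real.abs_sin_le_abs
    rw [abs_of_pos hs] at h1
    have := abs_nonneg (Real.sin s)
    nlinarith
  have hsinpos : ∀ s, 0 < s → s ≤ 1 → 0 < Real.sin s := fun s h0 h1 =>
    Real.sin_pos_of_pos_of_le_one h0 h1
  have hg₂ : ∀ s ∈ Ioc 0 ℓ, -(η / (1 - a) ^ 2) ≤ g₂ s := fun s hs => by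
    refine neg_le_of_abs_le ?_
    have hs0 := hs.1
    have hfs := hf s hs0
    simp only [g₂]
    rw [abs_div, abs_of_pos (hD s hs0), div_le_div_iff₀ (hD s hs0) (by positivity),
      abs_mul (a * Real.sin s), abs_mul _ (p s).im]
    have h1 : |f s ^ 2 - ε₁ * ε₂| ≤ f s ^ 2 + ε₁ * ε₂ := by
      rw [abs_le]
      constructor <;> nlinarith [mul_nonneg hε₁ hε₂0.le, sq_nonneg (f s)]
    have h2 := him s ⟨hs0.le, hs.2⟩
    have h3 : f s ^ 2 * (f s ^ 2 + ε₁ * ε₂) ≤ D s := by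
      simp only [D]
      nlinarith [mul_nonneg (sq_nonneg (f s)) (sq_nonneg (ε₁ - ε₂)),
        mul_nonneg (sq_nonneg (f s)) (mul_nonneg hε₁ hε₂0.le), sq_nonneg (ε₁ * ε₂)]
    have h4 : ((1 - a) * s) ^ 2 ≤ f s ^ 2 :=
      pow_le_pow_left₀ (by positivity) (hfl s hs0) 2
    calc |a * Real.sin s| * (|f s ^ 2 - ε₁ * ε₂| * |(p s).im|) * (1 - a) ^ 2
        ≤ s * ((f s ^ 2 + ε₁ * ε₂) * (η * s)) * (1 - a) ^ 2 := by
          gcongr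
          exact hsin s hs0
      _ = η * (((1 - a) * s) ^ 2 * (f s ^ 2 + ε₁ * ε₂)) := by ring
      _ ≤ η * (f s ^ 2 * (f s ^ 2 + ε₁ * ε₂)) := by gcongr
      _ ≤ η * D s := by gcongr
  have hg₁near : ∀ s ∈ Ioc 0 x₀, 0 ≤ g₁ s := fun s hs => by
    have h1 := hsinpos s hs.1 (hs.2.trans hx₀)
    have h2 := hnear s ⟨hs.1.le, hs.2⟩
    have h3 := hf s hs.1
    have h4 := hD s hs.1
    simp only [g₁]
    have : 0 ≤ (p s).re := by linarith
    positivity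
  have hg₁ : ∀ s ∈ Ioc 0 ℓ, -(2 * ε₂ * C / ((1 - a) ^ 3 * x₀ ^ 2)) ≤ g₁ s := fun s hs => by
    rcases le_or_gt s x₀ with h | h
    · refine le_trans ?_ (hg₁near s ⟨hs.1, h⟩)
      rw [neg_nonpos]
      positivity
    · refine neg_le_of_abs_le ?_
      have hs0 := hs.1
      have hfs := hf s hs0
      simp only [g₁]
      rw [abs_div, abs_of_pos (hD s hs0), div_le_div_iff₀ (hD s hs0) (by positivity),
        abs_mul (a * Real.sin s), abs_mul _ (p s).re, abs_mul (f s), abs_of_pos hfs, abs_of_nonneg (by linarith : 0 ≤ ε₁ + ε₂)]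
      have h2 := hre s ⟨hs0.le, hs.2⟩
      have h3 : f s * f s ^ 3 ≤ D s := by
        simp only [D]
        nlinarith [mul_nonneg (sq_nonneg (f s)) (sq_nonneg ε₁),
          mul_nonneg (sq_nonneg (f s)) (sq_nonneg ε₂), mul_nonneg (sq_nonneg ε₁) (sq_nonneg ε₂)]
      have h4 : ((1 - a) * s) ^ 3 ≤ f s ^ 3 :=
        pow_le_pow_left₀ (by positivity) (hfl s hs0) 3
      calc |a * Real.sin s| * (f s * (ε₁ + ε₂) * |(p s).re|) * ((1 - a) ^ 3 * x₀ ^ 2)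
          ≤ s * (f s * (2 * ε₂) * C) * ((1 - a) ^ 3 * s ^ 2) := by
            gcongr
            · exact hsin s hs0
            · linarith
        _ = 2 * ε₂ * C * (f s * ((1 - a) * s) ^ 3) := by ring
        _ ≤ 2 * ε₂ * C * (f s * f s ^ 3) := by gcongr
        _ ≤ 2 * ε₂ * C * D s := by gcongr
  have hg₁core : ∀ s ∈ Icc ε₂ (2 * ε₂), 1 / (2312 * ε₂) ≤ g₁ s := fun s hs => by
    have hs0 : 0 < s := hε₂0.trans_le hs.1
    have hs1 : s ≤ 1 := by linarith [hs.2]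
    have hfs := hf s hs0
    have h0 : s / 2 ≤ Real.sin s := by
      have h := Real.taylor_seven_le_sin hs0.le
      have h2 : s ^ 2 ≤ 1 := by nlinarith
      have h4 : s ^ 4 ≤ 1 := by nlinarith [sq_nonneg (s ^ 2)]
      nlinarith [mul_nonneg hs0.le (sub_nonneg.2 h2), mul_nonneg hs0.le (sq_nonneg (s ^ 2)),
        mul_nonneg (mul_nonneg hs0.le (sq_nonneg (s ^ 2))) (sub_nonneg.2 h2)]
    have h1 : s ≤ f s := by
      simp only [f, centredShear]
      nlinarith
    have h2 : f s ≤ 4 * ε₂ := (centredShear_le ha0 ha1 hs0.le).trans (by linarith [hs.2])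
    have h3 := hnear s ⟨hs0.le, by linarith [hs.2]⟩
    -- From f ≤ 4ε₂ each factor of D is at most 17ε₂². The numerator below is at least ε₂³/8, and
    -- 8·17² = 2312.
    have hDle : D s ≤ 289 * ε₂ ^ 4 := by
      have h5 : f s ^ 2 ≤ 16 * ε₂ ^ 2 := by nlinarith
      have h6 : ε₁ ^ 2 ≤ ε₂ ^ 2 := by nlinarith
      calc D s ≤ (16 * ε₂ ^ 2 + ε₂ ^ 2) * (16 * ε₂ ^ 2 + ε₂ ^ 2) := by
            simp only [D]; gcongr
        _ = 289 * ε₂ ^ 4 := by ring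
    simp only [g₁]
    rw [div_le_div_iff₀ (by positivity) (hD s hs0), one_mul]
    have h7 : 1 / 2 * (ε₂ / 2) * (ε₂ * ε₂ * (1 / 2)) ≤
        a * Real.sin s * (f s * (ε₁ + ε₂) * (p s).re) := by
      have h8 : 1 / 2 * (ε₂ / 2) ≤ a * Real.sin s :=
        mul_le_mul ha.le (by linarith [hs.1]) (by positivity) ha0.le
      have h9 : ε₂ * ε₂ ≤ f s * (ε₁ + ε₂) :=
        mul_le_mul (hs.1.trans h1) (by linarith) hε₂0.le hfs.le
      have h10 : 0 ≤ a * Real.sin s := le_trans (by positivity) h8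
      have h11 : 0 ≤ f s * (ε₁ + ε₂) := le_trans (by positivity) h9
      exact mul_le_mul h8 (mul_le_mul h9 h3 (by norm_num) h11) (by positivity) h10
    calc D s ≤ 289 * ε₂ ^ 4 := hDle
      _ = 1 / 2 * (ε₂ / 2) * (ε₂ * ε₂ * (1 / 2)) * (2312 * ε₂) := by ring
      _ ≤ _ := by gcongr
  have hδ : 0 < ε₂ - ε₁ := sub_pos.2 hε
  have hlow : ∀ s ∈ Ioc 0 ℓ, (ε₂ - ε₁) * (-κ) ≤ N s := fun s hs => by
    rw [hN s hs.1]
    refine mul_le_mul_of_nonneg_left ?_ hδ.le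
    linarith [hg₁ s hs, hg₂ s hs]
  have h2ℓ : 2 * ε₂ ≤ ℓ := by linarith
  have hcore : ∀ s ∈ Icc ε₂ (2 * ε₂), (ε₂ - ε₁) * (1 / (2312 * ε₂) - κ) ≤ N s := fun s hs => by
    have hs0 : 0 < s := hε₂0.trans_le hs.1
    rw [hN s hs0]
    refine mul_le_mul_of_nonneg_left ?_ hδ.le
    have : 0 ≤ 2 * ε₂ * C / ((1 - a) ^ 3 * x₀ ^ 2) := by positivity
    linarith [hg₁core s hs, hg₂ s ⟨hs0, hs.2.trans h2ℓ⟩]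
  have hi : ∀ u v, IntervalIntegrable N MeasureTheory.volume u v :=
    fun u v => hNc.intervalIntegrable u v
  have i1 : ε₂ * ((ε₂ - ε₁) * (-κ)) ≤ ∫ s in 0..ε₂, N s := by
    have := intervalIntegral.integral_mono_on_of_le_Ioo hε₂0.le
      (intervalIntegrable_const (c := (ε₂ - ε₁) * (-κ))) (hi 0 ε₂)
      fun s hs => hlow s ⟨hs.1, by linarith [hs.2]⟩
    rwa [intervalIntegral.integral_const, sub_zero, smul_eq_mul] at this
  have i2 : ε₂ * ((ε₂ - ε₁) * (1 / (2312 * ε₂) - κ)) ≤ ∫ s in ε₂..(2 * ε₂), N s := by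
    have := intervalIntegral.integral_mono_on_of_le_Ioo (by linarith : ε₂ ≤ 2 * ε₂)
      (intervalIntegrable_const (c := (ε₂ - ε₁) * (1 / (2312 * ε₂) - κ))) (hi ε₂ (2 * ε₂))
      fun s hs => hcore s (Ioo_subset_Icc_self hs)
    rw [intervalIntegral.integral_const, smul_eq_mul] at this
    refine le_trans (le_of_eq ?_) this
    ring
  have i3 : (ℓ - 2 * ε₂) * ((ε₂ - ε₁) * (-κ)) ≤ ∫ s in (2 * ε₂)..ℓ, N s := by
    have := intervalIntegral.integral_mono_on_of_le_Ioo h2ℓ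
      (intervalIntegrable_const (c := (ε₂ - ε₁) * (-κ))) (hi (2 * ε₂) ℓ)
      fun s hs => hlow s ⟨by linarith [hs.1], hs.2.le⟩
    rwa [intervalIntegral.integral_const, smul_eq_mul] at this
  have hsum : ∫ s in 0..ℓ, N s =
      (∫ s in 0..ε₂, N s) + (∫ s in ε₂..(2 * ε₂), N s) + ∫ s in (2 * ε₂)..ℓ, N s := by
    rw [intervalIntegral.integral_add_adjacent_intervals (hi _ _) (hi _ _),
      intervalIntegral.integral_add_adjacent_intervals (hi _ _) (hi _ _)]
  change 0 < ∫ s in 0..ℓ, N s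
  rw [hsum]
  have hfin : 0 < (ε₂ - ε₁) * (1 / 2312 - κ * ℓ) := mul_pos hδ (by linarith)
  have heq : ε₂ * ((ε₂ - ε₁) * (-κ)) + ε₂ * ((ε₂ - ε₁) * (1 / (2312 * ε₂) - κ)) +
      (ℓ - 2 * ε₂) * ((ε₂ - ε₁) * (-κ)) = (ε₂ - ε₁) * (1 / 2312 - κ * ℓ) := by
    field_simp
    ring
  linarith

/-- Lagrange's identity: ψ₂φ₁ − φ₂ψ₁ has derivative (Q₂ − Q₁)φ₁φ₂ and vanishes at ℓ. -/
theorem IsTerminalSolution.re_div_sub_re_div {Q₁ Q₂ φ₁ ψ₁ φ₂ ψ₂ : ℝ → ℂ} {ℓ : ℝ}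
    (h₁ : IsTerminalSolution Q₁ ℓ φ₁ ψ₁) (h₂ : IsTerminalSolution Q₂ ℓ φ₂ ψ₂) (hℓ : 0 ≤ ℓ)
    (hQ₁ : Continuous Q₁) (hQ₂ : Continuous Q₂) (hn₁ : φ₁ 0 ≠ 0) (hn₂ : φ₂ 0 ≠ 0) :
    (ψ₁ 0 / φ₁ 0).re - (ψ₂ 0 / φ₂ 0).re =
      ∫ s in 0..ℓ, ((Q₂ s - Q₁ s) * (φ₁ s / φ₁ 0 * (φ₂ s / φ₂ 0))).re := by
  have c1 := h₁.continuous_fst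
  have c2 := h₂.continuous_fst
  have hd : ∀ x ∈ uIcc 0 ℓ, HasDerivAt
      (fun x => ((ψ₂ x * φ₁ x - φ₂ x * ψ₁ x) / (φ₁ 0 * φ₂ 0)).re)
      ((Q₂ x - Q₁ x) * (φ₁ x / φ₁ 0 * (φ₂ x / φ₂ 0))).re x := fun x hx => by
    rw [uIcc_of_le hℓ] at hx
    have := ((((h₂.hasDerivAt_snd x hx).mul (h₁.hasDerivAt_fst x hx)).sub
      ((h₂.hasDerivAt_fst x hx).mul (h₁.hasDerivAt_snd x hx))).div_const (φ₁ 0 * φ₂ 0)).re_comp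
    refine this.congr_deriv (congrArg _ ?_)
    field_simp
    ring
  rw [intervalIntegral.integral_eq_sub_of_hasDerivAt hd
    (Continuous.intervalIntegrable (by fun_prop) _ _), h₁.fst_end, h₂.fst_end]
  simp only [mul_zero, zero_mul, sub_zero, zero_div, Complex.zero_re, zero_sub]
  rw [← Complex.sub_re, ← Complex.neg_re]
  congr 1
  field_simp
  ring

/-- Only monotonicity in ε and continuity are used, no derivative of R, and ε is confined to [0, r).
Zeros come from the intermediate value theorem on [0, r/2]; strict monotonicity makes them unique
and continuous in μ. -/
theorem exists_continuousOn_zero_branch {R : ℝ → ℝ → ℝ} {μ₀ r : ℝ} (hr : 0 < r)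
    (hcont : ∀ μ ε, |μ - μ₀| < r → 0 ≤ ε → ε < r → ContinuousAt (Function.uncurry R) (μ, ε))
    (hanti : ∀ μ, |μ - μ₀| < r → ∀ ε₁ ε₂, 0 ≤ ε₁ → ε₁ < ε₂ → ε₂ < r → R μ ε₂ < R μ ε₁)
    (h0 : R μ₀ 0 = 0) (hpos : ∀ μ, |μ - μ₀| < r → μ < μ₀ → 0 < R μ 0) :
    ∃ δ, 0 < δ ∧ δ ≤ r ∧ ∃ e : ℝ → ℝ, ContinuousOn e (Ioc (μ₀ - δ) μ₀) ∧ e μ₀ = 0 ∧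
      ∀ μ ∈ Ioo (μ₀ - δ) μ₀, 0 < e μ ∧ e μ < r ∧ R μ (e μ) = 0 := by
  have hμ₀ : |μ₀ - μ₀| < r := by simpa using hr
  have hfst : ∀ μ ε, |μ - μ₀| < r → 0 ≤ ε → ε < r → ContinuousAt (fun μ => R μ ε) μ :=
    fun μ ε h h1 h2 => ContinuousAt.comp (f := fun μ : ℝ => (μ, ε)) (hcont μ ε h h1 h2)
      (by fun_prop)
  have hbar : R μ₀ (r / 2) < 0 := by
    rw [← h0]
    exact hanti μ₀ hμ₀ 0 (r / 2) le_rfl (by linarith) (by linarith)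
  obtain ⟨δ₁, hδ₁, hball⟩ := Metric.eventually_nhds_iff.1
    ((hfst μ₀ (r / 2) hμ₀ (by linarith) (by linarith)).eventually_lt continuousAt_const hbar)
  let δ := min δ₁ r
  have hδ : 0 < δ := lt_min hδ₁ hr
  have hIoc : ∀ μ ∈ Ioc (μ₀ - δ) μ₀, |μ - μ₀| < r ∧ R μ (r / 2) < 0 := fun μ hμ => by
    have h1 : |μ - μ₀| < δ := by rw [abs_lt]; constructor <;> linarith [hμ.1, hμ.2]
    exact ⟨h1.trans_le (min_le_right _ _), hball (h1.trans_le (min_le_left _ _))⟩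
  have hzero : ∀ μ ∈ Ioc (μ₀ - δ) μ₀, ∃ ε, 0 ≤ ε ∧ ε < r / 2 ∧ R μ ε = 0 := fun μ hμ => by
    obtain ⟨h1, h2⟩ := hIoc μ hμ
    have hc : ContinuousOn (R μ) (Icc 0 (r / 2)) := fun ε hε =>
      (ContinuousAt.comp (f := fun ε : ℝ => (μ, ε))
        (hcont μ ε h1 hε.1 (by linarith [hε.2])) (by fun_prop)).continuousWithinAt
    have h3 : 0 ≤ R μ 0 := by
      rcases hμ.2.eq_or_lt with rfl | hlt
      · exact h0.ge
      · exact (hpos μ h1 hlt).le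
    obtain ⟨ε, hε, hR⟩ := intermediate_value_Icc' (by linarith) hc ⟨h2.le, h3⟩
    refine ⟨ε, hε.1, lt_of_le_of_ne hε.2 ?_, hR⟩
    rintro rfl
    linarith
  choose! e he0 her heR using hzero
  have hmem₀ : μ₀ ∈ Ioc (μ₀ - δ) μ₀ := ⟨by linarith, le_rfl⟩
  refine ⟨δ, hδ, min_le_right _ _, e, fun μ hμ => ?_, ?_, fun μ hμ => ?_⟩
  · obtain ⟨h1, h2⟩ := hIoc μ hμ
    -- If 0 ≤ b < e(μ), then R(μ, b) > 0. This persists for ν near μ and forces e(ν) > b. Upper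
    -- bounds are symmetric.
    refine tendsto_order.2 ⟨fun b hb => ?_, fun b hb => ?_⟩
    · rcases lt_or_ge b 0 with hb0 | hb0
      · filter_upwards [self_mem_nhdsWithin] with ν hν
        exact hb0.trans_le (he0 ν hν)
      · have hlt : 0 < R μ b := by
          rw [← heR μ hμ]
          exact hanti μ h1 b (e μ) hb0 hb (by linarith [her μ hμ])
        have hbr : b < r := by linarith [her μ hμ]
        filter_upwards [self_mem_nhdsWithin, mem_nhdsWithin_of_mem_nhds
          (continuousAt_const.eventually_lt (hfst μ b h1 hb0 hbr) hlt)] with ν hν hνR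
        by_contra! hle
        rcases hle.eq_or_lt with heq | hlt'
        · have := heR ν hν
          rw [heq] at this
          exact absurd this hνR.ne'
        · have := hanti ν (hIoc ν hν).1 (e ν) b (he0 ν hν) hlt' hbr
          rw [heR ν hν] at this
          exact absurd this hνR.not_gt
    · rcases lt_or_ge (r / 2) b with hb0 | hb0
      · filter_upwards [self_mem_nhdsWithin] with ν hν
        exact (her ν hν).trans hb0
      · have hbr : b < r := by linarith
        have hbn : 0 ≤ b := (he0 μ hμ).trans hb.le
        have hlt : R μ b < 0 := by
          rw [← heR μ hμ]
          exact hanti μ h1 (e μ) b (he0 μ hμ) hb hbr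
        filter_upwards [self_mem_nhdsWithin, mem_nhdsWithin_of_mem_nhds
          ((hfst μ b h1 hbn hbr).eventually_lt continuousAt_const hlt)] with ν hν hνR
        by_contra! hle
        rcases hle.eq_or_lt with heq | hlt'
        · have := heR ν hν
          rw [← heq] at this
          exact absurd this hνR.ne
        · have := hanti ν (hIoc ν hν).1 b (e ν) hbn hlt' (by linarith [her ν hν])
          rw [heR ν hν] at this
          exact absurd this hνR.not_gt
  · by_contra hne
    have hlt : 0 < e μ₀ := lt_of_le_of_ne (he0 μ₀ hmem₀) (Ne.symm hne)
    have := hanti μ₀ hμ₀ 0 (e μ₀) le_rfl hlt (by linarith [her μ₀ hmem₀])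
    rw [heR μ₀ hmem₀, h0] at this
    exact lt_irrefl _ this
  · have hμ' := Ioo_subset_Ioc_self hμ
    refine ⟨lt_of_le_of_ne (he0 μ hμ') fun h => ?_, by linarith [her μ hμ'], heR μ hμ'⟩
    have h1 := hpos μ (hIoc μ hμ').1 hμ.2
    have h2 := heR μ hμ'
    rw [← h] at h2
    linarith

/-! ### Uniform estimates and the unstable branch in scaled variables. -/

open Filter Topology

/-- The quotient φ/φ(0) equals 1 at 0, so bounds on its derivative give bounds proportional to x.
The imaginary part of that derivative is small because ψ/φ(0) is close to the real quotient ψ₀/A. -/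
theorem IsTerminalSolution.normalized_bounds {Q φ ψ φ₀ ψ₀ : ℝ → ℂ} {ℓ A B d : ℝ}
    (h : IsTerminalSolution Q ℓ φ ψ) (hℓ : 0 ≤ ℓ) (hA : 0 < A) (hφ₀ : φ₀ 0 = A)
    (hψ₀ : ∀ x ∈ Icc 0 ℓ, (ψ₀ x).im = 0) (hB : ∀ x ∈ Icc 0 ℓ, ‖φ x‖ ≤ B ∧ ‖ψ x‖ ≤ B)
    (hd : d ≤ A / 2) (hclose : ∀ x ∈ Icc 0 ℓ, ‖φ x - φ₀ x‖ ≤ d ∧ ‖ψ x - ψ₀ x‖ ≤ d) :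
    φ 0 ≠ 0 ∧ ∀ x ∈ Icc 0 ℓ, ‖φ x / φ 0‖ ≤ 2 * B / A ∧ ‖φ x / φ 0 - 1‖ ≤ 2 * B / A * x ∧
      |(φ x / φ 0).im| ≤ d * (1 / A + 2 * B / A ^ 2) * x := by
  have hmem : (0 : ℝ) ∈ Icc 0 ℓ := ⟨le_rfl, hℓ⟩
  have hB0 : 0 ≤ B := (norm_nonneg _).trans (hB 0 hmem).1
  have hdist : ‖φ 0 - A‖ ≤ d := hφ₀ ▸ (hclose 0 hmem).1
  have hd0 : 0 ≤ d := (norm_nonneg _).trans hdist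
  have hlow : A / 2 ≤ ‖φ 0‖ := by
    have h1 := norm_sub_norm_le (A : ℂ) (φ 0)
    rw [norm_sub_rev, Complex.norm_real, Real.norm_eq_abs, abs_of_pos hA] at h1
    linarith
  have hpos : 0 < ‖φ 0‖ := by linarith
  have hne : φ 0 ≠ 0 := norm_pos_iff.1 hpos
  have hAc : (A : ℂ) ≠ 0 := by exact_mod_cast hA.ne'
  have hquot : ∀ z : ℂ, ‖z‖ ≤ B → ‖z / φ 0‖ ≤ 2 * B / A := fun z hz => by
    rw [norm_div, div_le_div_iff₀ hpos hA]
    nlinarith [mul_le_mul_of_nonneg_left hlow hB0, mul_le_mul_of_nonneg_right hz hA.le]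
  have hderiv : ∀ x ∈ Icc 0 ℓ,
      HasDerivWithinAt (fun x => φ x / φ 0) (ψ x / φ 0) (Icc 0 ℓ) x := fun x hx =>
    ((h.hasDerivAt_fst x hx).div_const _).hasDerivWithinAt
  have him : ∀ x ∈ Icc 0 ℓ, |(ψ x / φ 0).im| ≤ d * (1 / A + 2 * B / A ^ 2) := fun x hx => by
    have e : ψ x / φ 0 - ψ₀ x / A = ψ x / φ 0 * ((A - φ 0) / A) + (ψ x - ψ₀ x) / A := by
      field_simp
      ring
    have h1 : (ψ x / φ 0).im = (ψ x / φ 0 - ψ₀ x / A).im := by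
      rw [Complex.sub_im, Complex.div_ofReal_im, hψ₀ x hx]
      simp
    rw [h1, e]
    refine (Complex.abs_im_le_norm _).trans ((norm_add_le _ _).trans ?_)
    rw [norm_mul, norm_div _ (A : ℂ), norm_div _ (A : ℂ), Complex.norm_real, Real.norm_eq_abs,
      abs_of_pos hA, norm_sub_rev]
    have h2 := hquot _ (hB x hx).2
    calc ‖ψ x / φ 0‖ * (‖φ 0 - A‖ / A) + ‖ψ x - ψ₀ x‖ / A
        ≤ 2 * B / A * (d / A) + d / A := by
          gcongr
          exact (hclose x hx).2
      _ = d * (1 / A + 2 * B / A ^ 2) := by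
          field_simp
          ring
  refine ⟨hne, fun x hx => ⟨hquot _ (hB x hx).1, ?_, ?_⟩⟩
  · have := norm_image_sub_le_of_norm_deriv_le_segment' hderiv
      (fun y hy => hquot _ (hB y (Ico_subset_Icc_self hy)).2) x hx
    simpa [hne] using this
  · have := norm_image_sub_le_of_norm_deriv_le_segment' (a := 0) (b := ℓ)
      (f := fun x => (φ x / φ 0).im) (f' := fun x => (ψ x / φ 0).im)
      (fun y hy => (((h.hasDerivAt_fst y hy).div_const _).im_comp).hasDerivWithinAt)
      (fun y hy => him y (Ico_subset_Icc_self hy)) x hx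
    simpa [hne] using this

theorem continuous_sub_rayleighPotential (ha : 0 < a) (ha1 : a < 1) (μ ε : ℝ) :
    Continuous fun s => (μ : ℂ) - rayleighPotential a ε s :=
  continuous_const.sub (continuous_rayleighPotential ha ha1 ε)

theorem norm_sub_rayleighPotential_le (ha : 0 < a) (ha1 : a < 1) {μ : ℝ} (hμ : |μ| ≤ 2) (ε s : ℝ) :
    ‖(μ : ℂ) - rayleighPotential a ε s‖ ≤ 2 + a / (1 - a) := by
  refine (norm_sub_le _ _).trans (_root_.add_le_add ?_ (norm_rayleighPotential_le ha ha1 ε s))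
  rwa [Complex.norm_real]

theorem eventually_norm_sub_add_norm_sub_le (ha : 0 < a) (ha1 : a < 1) {ℓ : ℝ} (hℓ : 0 ≤ ℓ)
    {φ ψ : ℝ → ℝ → ℝ → ℂ}
    (hsol : ∀ μ ε : ℝ, IsTerminalSolution (fun s => (μ : ℂ) - rayleighPotential a ε s) ℓ
      (φ μ ε) (ψ μ ε)) {μ₀ : ℝ} (ε₀ : ℝ) (hμ₀ : |μ₀| < 2) {d : ℝ} (hd : 0 < d) :
    ∀ᶠ p : ℝ × ℝ in 𝓝 (μ₀, ε₀), ∀ x ∈ Icc 0 ℓ,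
      ‖φ p.1 p.2 x - φ μ₀ ε₀ x‖ + ‖ψ p.1 p.2 x - ψ μ₀ ε₀ x‖ < d := by
  set C := Real.exp ((1 + (2 + a / (1 - a))) * ℓ) ^ 2
  have hlim : Tendsto (fun p : ℝ × ℝ => C * (|p.1 - μ₀| * ℓ +
      ∫ t in 0..ℓ, ‖rayleighPotential a p.2 t - rayleighPotential a ε₀ t‖)) (𝓝 (μ₀, ε₀))
      (𝓝 (C * (0 * ℓ + 0))) := by
    refine Tendsto.const_mul C (Tendsto.add (Tendsto.mul_const ℓ ?_) ?_)
    · have : ContinuousAt (fun p : ℝ × ℝ => |p.1 - μ₀|) (μ₀, ε₀) := by fun_prop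
      simpa [ContinuousAt] using this
    · exact (tendsto_integral_norm_rayleighPotential_sub ha ha1 ℓ ε₀).comp
        (continuous_snd.tendsto (μ₀, ε₀))
  have hlt : C * (0 * ℓ + 0) < d := by simpa using hd
  have hμ : ∀ᶠ p : ℝ × ℝ in 𝓝 (μ₀, ε₀), |p.1| < 2 :=
    ContinuousAt.eventually_lt (by fun_prop) continuousAt_const hμ₀
  filter_upwards [hlim.eventually_lt_const hlt, hμ] with p hp hpμ x hx
  refine lt_of_le_of_lt ((hsol p.1 p.2).norm_sub_add_norm_sub_le (hsol μ₀ ε₀) hℓ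
    (continuous_sub_rayleighPotential ha ha1 _ _) (continuous_sub_rayleighPotential ha ha1 _ _)
    (fun x _ => norm_sub_rayleighPotential_le ha ha1 hpμ.le _ x)
    (fun x _ => norm_sub_rayleighPotential_le ha ha1 hμ₀.le _ x) x hx) (lt_of_le_of_lt ?_ hp)
  refine mul_le_mul_of_nonneg_left ?_ (by positivity)
  have c1 := continuous_rayleighPotential ha ha1 p.2
  have c2 := continuous_rayleighPotential ha ha1 ε₀
  have e : |p.1 - μ₀| * ℓ + ∫ t in 0..ℓ, ‖rayleighPotential a p.2 t - rayleighPotential a ε₀ t‖ =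
      ∫ t in 0..ℓ, (|p.1 - μ₀| + ‖rayleighPotential a p.2 t - rayleighPotential a ε₀ t‖) := by
    rw [intervalIntegral.integral_add (Continuous.intervalIntegrable (by fun_prop) _ _)
      (Continuous.intervalIntegrable (by fun_prop) _ _), intervalIntegral.integral_const]
    simp [mul_comm]
  rw [e]
  refine intervalIntegral.integral_mono_on hℓ (Continuous.intervalIntegrable (by fun_prop) _ _)
    (Continuous.intervalIntegrable (by fun_prop) _ _) fun t _ => ?_
  have e2 : (p.1 : ℂ) - rayleighPotential a p.2 t - (μ₀ - rayleighPotential a ε₀ t) =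
      ((p.1 - μ₀ : ℝ) : ℂ) - (rayleighPotential a p.2 t - rayleighPotential a ε₀ t) := by
    push_cast; ring
  rw [e2]
  refine (norm_sub_le _ _).trans (_root_.add_le_add ?_ le_rfl)
  rw [Complex.norm_real, Real.norm_eq_abs]

theorem exists_unstable_branch (ha : 1 / 2 < a) (ha1 : a < 1) {ℓ : ℝ} (hℓ : 31 / 10 < ℓ) :
    ∃ μ₀ : ℝ, 1 / 144 ≤ μ₀ ∧
      (∃ φ ψ, IsTerminalSolution (fun s => (μ₀ : ℂ) - rayleighPotential a 0 s) ℓ φ ψ ∧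
        φ 0 ≠ 0 ∧ (ψ 0 / φ 0).re = 0) ∧
      ∃ δ, 0 < δ ∧ δ < μ₀ ∧ ∃ e : ℝ → ℝ, ContinuousOn e (Ioc (μ₀ - δ) μ₀) ∧ e μ₀ = 0 ∧
        ∀ μ ∈ Ioo (μ₀ - δ) μ₀, 0 < e μ ∧
          ∃ φ ψ, IsTerminalSolution (fun s => (μ : ℂ) - rayleighPotential a (e μ) s) ℓ φ ψ ∧
            φ 0 ≠ 0 ∧ (ψ 0 / φ 0).re = 0 := by
  have ha0 : 0 < a := by linarith
  have h1a : 0 < 1 - a := by linarith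
  have hℓ0 : 0 < ℓ := by linarith
  have hmem : (0 : ℝ) ∈ Icc 0 ℓ := ⟨le_rfl, hℓ0.le⟩
  have hQc := continuous_sub_rayleighPotential ha0 ha1
  have hex : ∀ μ ε : ℝ, ∃ φ ψ,
      IsTerminalSolution (fun s => (μ : ℂ) - rayleighPotential a ε s) ℓ φ ψ := fun μ ε =>
    exists_isTerminalSolution (M := |μ| + a / (1 - a)) hℓ0.le (hQc μ ε) fun x _ =>
      (norm_sub_le _ _).trans (_root_.add_le_add (by rw [Complex.norm_real, Real.norm_eq_abs])
        (norm_rayleighPotential_le ha0 ha1 ε x))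
  choose φ ψ hsol using hex
  have hclose := fun (μ₀ ε₀ : ℝ) (hμ₀ : |μ₀| < 2) (d : ℝ) (hd : 0 < d) =>
    eventually_norm_sub_add_norm_sub_le ha0 ha1 hℓ0.le hsol ε₀ hμ₀ hd
  have hφψc : ∀ μ ε : ℝ, |μ| < 2 →
      ContinuousAt (fun p : ℝ × ℝ => φ p.1 p.2 0) (μ, ε) ∧
      ContinuousAt (fun p : ℝ × ℝ => ψ p.1 p.2 0) (μ, ε) := fun μ ε hμ => by
    constructor <;> refine Metric.tendsto_nhds.2 fun d hd => ?_
    · filter_upwards [hclose μ ε hμ d hd] with p hp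
      rw [dist_eq_norm]
      linarith [hp 0 hmem, norm_nonneg (ψ p.1 p.2 0 - ψ μ ε 0)]
    · filter_upwards [hclose μ ε hμ d hd] with p hp
      rw [dist_eq_norm]
      linarith [hp 0 hmem, norm_nonneg (φ p.1 p.2 0 - φ μ ε 0)]
  have hneut := fun μ => (hsol μ 0).isNeutralSolution
  obtain ⟨μ₀, hμ₀, hw₀⟩ : ∃ μ₀ ∈ Icc (1 / 144 : ℝ) 1, (ψ μ₀ 0 0).re = 0 := by
    refine intermediate_value_Icc' (by norm_num) (f := fun μ => (ψ μ 0 0).re) (fun μ hμ => ?_)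
      ⟨((hneut 1).deriv_zero_neg_of_one ha0 ha1 hℓ0).le,
        ((hneut (1 / 144)).deriv_zero_pos ha ha1 hℓ).le⟩
    have h2 : |μ| < 2 := by rw [abs_lt]; constructor <;> linarith [hμ.1, hμ.2]
    exact (Complex.continuous_re.continuousAt.comp (ContinuousAt.comp
      (f := fun μ : ℝ => (μ, (0 : ℝ))) (hφψc μ 0 h2).2 (by fun_prop))).continuousWithinAt
  have hμ₀2 : |μ₀| < 2 := by rw [abs_lt]; constructor <;> linarith [hμ₀.1, hμ₀.2]
  have hμ₀0 : 0 ≤ μ₀ := by linarith [hμ₀.1]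
  set A := (φ μ₀ 0 0).re with hAdef
  have hA : 0 < A := (hneut μ₀).pos ha0 ha1 hℓ0 hμ₀0 0 ⟨le_rfl, hℓ0⟩
  have hreal : ∀ μ : ℝ, |μ| < 2 → ∀ x ∈ Icc 0 ℓ, (φ μ 0 x).im = 0 ∧ (ψ μ 0 x).im = 0 :=
    fun μ hμ => (hsol μ 0).im_eq_zero hℓ0.le (hQc μ 0)
      (fun x _ => norm_sub_rayleighPotential_le ha0 ha1 hμ.le 0 x) fun x => by
        rw [rayleighPotential_zero, ← Complex.ofReal_sub, Complex.ofReal_im]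
  have hφA : φ μ₀ 0 0 = A := Complex.ext rfl (by
    rw [(hreal μ₀ hμ₀2 0 hmem).1, Complex.ofReal_im])
  have hψ0 : ψ μ₀ 0 0 = 0 := Complex.ext hw₀ (hreal μ₀ hμ₀2 0 hmem).2
  set B := Real.exp ((1 + (2 + a / (1 - a))) * ℓ) with hBdef
  have hB : ∀ μ ε : ℝ, |μ| ≤ 2 → ∀ x ∈ Icc 0 ℓ, ‖φ μ ε x‖ ≤ B ∧ ‖ψ μ ε x‖ ≤ B :=
    fun μ ε hμ x hx => by
      have := (hsol μ ε).norm_add_norm_le hℓ0.le (hQc μ ε)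
        (fun x _ => norm_sub_rayleighPotential_le ha0 ha1 hμ ε x) x hx
      constructor <;> linarith [norm_nonneg (φ μ ε x), norm_nonneg (ψ μ ε x)]
  have hB0 : 0 < B := Real.exp_pos _
  have hAB : A ≤ B := by
    have := (hB μ₀ 0 hμ₀2.le 0 hmem).1
    rwa [hφA, Complex.norm_real, Real.norm_eq_abs, abs_of_pos hA] at this
  -- C bounds the normalized solutions and their slopes. The choice Cx₀ = 1/8 keeps both factors of
  -- p within 1/8 of 1 on [0, x₀], hence Re p ≥ 1/2 there.
  set C := 2 * B / A with hCdef
  have hC1 : 1 ≤ C := by rw [hCdef, le_div_iff₀ hA]; linarith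
  have hC0 : 0 < C := by linarith
  set x₀ := 1 / (8 * C) with hx₀def
  have hx₀0 : 0 < x₀ := by positivity
  have hx₀1 : x₀ ≤ 1 := by rw [hx₀def, div_le_one (by positivity)]; linarith
  have hCx₀ : C * x₀ = 1 / 8 := by rw [hx₀def]; field_simp
  set c₁ := 2 * C * (1 / A + 2 * B / A ^ 2) / (1 - a) ^ 2 with hc₁
  set c₂ := 2 * C ^ 2 / ((1 - a) ^ 3 * x₀ ^ 2) with hc₂
  have hc₁0 : 0 ≤ c₁ := by positivity
  have hc₂0 : 0 ≤ c₂ := by positivity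
  -- The losses from Im p and from s > x₀ are c₁d and c₂ε₂. With d, ε₂ ≤ t their sum times ℓ stays
  -- below 1/2312 = 2/4624.
  set t := 1 / (4624 * ℓ * (c₁ + c₂ + 1)) with htdef
  have ht : 0 < t := by positivity
  have htκ : (c₁ + c₂) * t * ℓ < 1 / 2312 := by
    rw [htdef]
    have : (c₁ + c₂) * (1 / (4624 * ℓ * (c₁ + c₂ + 1))) * ℓ =
        (c₁ + c₂) / (4624 * (c₁ + c₂ + 1)) := by field_simp
    rw [this, div_lt_div_iff₀ (by positivity) (by norm_num)]
    linarith
  set d := min (A / 2) t with hddef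
  have hd : 0 < d := lt_min (by positivity) ht
  obtain ⟨r₁, hr₁, hball⟩ := Metric.eventually_nhds_iff.1 (hclose μ₀ 0 hμ₀2 d hd)
  -- The bound x₀/2 ensures 2ε₂ ≤ x₀; the bound 1/288 keeps μ positive and δ < μ₀, since μ₀ ≥ 1/144.
  set r := min (min r₁ t) (min (x₀ / 2) (1 / 288)) with hrdef
  have hr : 0 < r := lt_min (lt_min hr₁ ht) (lt_min (by positivity) (by norm_num))
  have hrr₁ : r ≤ r₁ := (min_le_left _ _).trans (min_le_left _ _)
  have hrt : r ≤ t := (min_le_left _ _).trans (min_le_right _ _)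
  have hrx₀ : r ≤ x₀ / 2 := (min_le_right _ _).trans (min_le_left _ _)
  have hr288 : r ≤ 1 / 288 := (min_le_right _ _).trans (min_le_right _ _)
  have hμ2 : ∀ μ : ℝ, |μ - μ₀| < r → |μ| < 2 ∧ 0 ≤ μ := fun μ hμ => by
    rw [abs_lt] at hμ
    refine ⟨abs_lt.2 ⟨?_, ?_⟩, ?_⟩ <;> linarith [hμ.1, hμ.2, hμ₀.1, hμ₀.2]
  have hnorm : ∀ μ ε : ℝ, |μ - μ₀| < r → 0 ≤ ε → ε < r → φ μ ε 0 ≠ 0 ∧ ∀ x ∈ Icc 0 ℓ,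
      ‖φ μ ε x / φ μ ε 0‖ ≤ C ∧ ‖φ μ ε x / φ μ ε 0 - 1‖ ≤ C * x ∧
      |(φ μ ε x / φ μ ε 0).im| ≤ d * (1 / A + 2 * B / A ^ 2) * x := fun μ ε hμ hε hεr =>
    (hsol μ ε).normalized_bounds (ψ₀ := ψ μ₀ 0) hℓ0.le hA hφA
      (fun x hx => (hreal μ₀ hμ₀2 x hx).2)
      (hB μ ε (hμ2 μ hμ).1.le) (min_le_left _ _) fun x hx => by
        have hp : dist ((μ, ε) : ℝ × ℝ) (μ₀, 0) < r₁ := by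
          rw [Prod.dist_eq, Real.dist_eq, Real.dist_eq, sub_zero, abs_of_nonneg hε]
          exact max_lt (hμ.trans_le hrr₁) (hεr.trans_le hrr₁)
        have := hball hp x hx
        simp only at this
        constructor <;>
        linarith [norm_nonneg (φ μ ε x - φ μ₀ 0 x), norm_nonneg (ψ μ ε x - ψ μ₀ 0 x)]
  let R : ℝ → ℝ → ℝ := fun μ ε => (ψ μ ε 0 / φ μ ε 0).re
  obtain ⟨δ, hδ, hδr, e, hec, he0, he⟩ := exists_continuousOn_zero_branch (R := R) (μ₀ := μ₀) hr
    (fun μ ε hμ hε hεr => by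
      obtain ⟨h1, h2⟩ := hφψc μ ε (hμ2 μ hμ).1
      exact Complex.continuous_re.continuousAt.comp (h2.div h1 (hnorm μ ε hμ hε hεr).1))
    (fun μ hμ ε₁ ε₂ hε₁ hε hε₂ => by
      obtain ⟨n₁, b₁⟩ := hnorm μ ε₁ hμ hε₁ (hε.trans hε₂)
      obtain ⟨n₂, b₂⟩ := hnorm μ ε₂ hμ (hε₁.trans hε.le) hε₂
      have hW := (hsol μ ε₁).re_div_sub_re_div (hsol μ ε₂) hℓ0.le (hQc μ ε₁) (hQc μ ε₂) n₁ n₂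
      have hc1 := (hsol μ ε₁).continuous_fst
      have hc2 := (hsol μ ε₂).continuous_fst
      have hdA : 0 ≤ 1 / A + 2 * B / A ^ 2 := by positivity
      have hpos := integral_re_rayleighPotential_sub_mul_pos (ε₁ := ε₁) (ε₂ := ε₂) (ℓ := ℓ)
        (x₀ := x₀) (C := C ^ 2) (η := 2 * C * (d * (1 / A + 2 * B / A ^ 2)))
        (κ := (c₁ + c₂) * t) (p := fun x => φ μ ε₁ x / φ μ ε₁ 0 * (φ μ ε₂ x / φ μ ε₂ 0))
        ha ha1 hε₁ hε (by linarith) hx₀1 (by linarith) (by positivity) (by positivity) ?_ htκ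
        (by fun_prop) (fun s hs => ?_) (fun s hs => ?_) (fun s hs => ?_)
      · have e1 : ∀ s, (μ : ℂ) - rayleighPotential a ε₂ s - (μ - rayleighPotential a ε₁ s) =
            rayleighPotential a ε₁ s - rayleighPotential a ε₂ s := fun s => by ring
        simp only [e1] at hW
        simp only [R]
        linarith
      · have e1 : 2 * C * (d * (1 / A + 2 * B / A ^ 2)) / (1 - a) ^ 2 = c₁ * d := by
          rw [hc₁]; ring
        have e2 : 2 * ε₂ * C ^ 2 / ((1 - a) ^ 3 * x₀ ^ 2) = c₂ * ε₂ := by rw [hc₂]; ring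
        rw [e1, e2, add_mul]
        exact add_le_add (mul_le_mul_of_nonneg_left (min_le_right _ _) hc₁0)
          (mul_le_mul_of_nonneg_left (hε₂.le.trans hrt) hc₂0)
      · refine (Complex.abs_re_le_norm _).trans ?_
        rw [norm_mul, sq]
        exact mul_le_mul (b₁ s hs).1 (b₂ s hs).1 (norm_nonneg _) hC0.le
      · rw [Complex.mul_im]
        refine (abs_add_le _ _).trans ?_
        rw [abs_mul, abs_mul]
        have h1 := (Complex.abs_re_le_norm _).trans (b₁ s hs).1
        have h2 := (Complex.abs_re_le_norm _).trans (b₂ s hs).1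
        have h3 := mul_le_mul h1 (b₂ s hs).2.2 (abs_nonneg _) hC0.le
        have h4 := mul_le_mul (b₁ s hs).2.2 h2 (abs_nonneg _)
          (mul_nonneg (mul_nonneg hd.le hdA) hs.1)
        linarith
      · have hs' : s ∈ Icc 0 ℓ := ⟨hs.1, by linarith [hs.2]⟩
        have hCs : C * s ≤ 1 / 8 := by
          rw [← hCx₀]
          exact mul_le_mul_of_nonneg_left hs.2 hC0.le
        have h1 := (b₁ s hs').2.1.trans hCs
        have h2 := (b₂ s hs').2.1.trans hCs
        set z₁ := φ μ ε₁ s / φ μ ε₁ 0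
        set z₂ := φ μ ε₂ s / φ μ ε₂ 0
        have e1 : z₁ * z₂ = 1 + ((z₁ - 1) + (z₂ - 1) + (z₁ - 1) * (z₂ - 1)) := by ring
        have h3 : ‖(z₁ - 1) + (z₂ - 1) + (z₁ - 1) * (z₂ - 1)‖ ≤ 1 / 8 + 1 / 8 + 1 / 8 * (1 / 8) := by
          refine (norm_add₃_le).trans ?_
          rw [norm_mul]
          gcongr
        have h4 := neg_le_of_abs_le ((Complex.abs_re_le_norm _).trans h3)
        rw [e1, Complex.add_re, Complex.one_re]
        linarith)
    (by simp [R, hψ0])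
    (fun μ hμ hlt => by
      have h1 := hμ2 μ hμ
      have hw := (hneut μ).deriv_zero_pos_of_lt (hneut μ₀) ha0 ha1 hℓ0 h1.2 hlt hw₀
      have hu := (hneut μ).pos ha0 ha1 hℓ0 h1.2 0 ⟨le_rfl, hℓ0⟩
      have eφ : φ μ 0 0 = ((φ μ 0 0).re : ℂ) := Complex.ext rfl (by
        rw [(hreal μ h1.1 0 hmem).1, Complex.ofReal_im])
      simp only [R]
      rw [eφ, Complex.div_ofReal_re]
      exact div_pos hw hu)
  refine ⟨μ₀, hμ₀.1, ⟨_, _, hsol μ₀ 0, by rw [hφA]; exact_mod_cast hA.ne', by simp [hψ0]⟩,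
    δ, hδ, by linarith [hμ₀.1], e, hec, he0, fun μ hμ => ?_⟩
  obtain ⟨h1, h2, h3⟩ := he μ hμ
  have hμr : |μ - μ₀| < r := by rw [abs_lt]; constructor <;> linarith [hμ.1, hμ.2]
  exact ⟨h1, _, _, hsol μ (e μ), (hnorm μ (e μ) hμr h1.le h2).1, h3⟩

/-! ### Return to the channel: eigenfunctions, regularity and Euler solutions. -/

theorem contDiff_oscillatoryShear (A : ℝ) (n : ℕ) :
    ContDiff ℝ (⊤ : ℕ∞) (oscillatoryShear A n) := by
  unfold oscillatoryShear
  fun_prop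

theorem oscillatoryShear_eq (A : ℝ) {n : ℕ} (hn : 1 ≤ n) (y : ℝ) :
    oscillatoryShear A n y = 1 / 2 +
      centredShear (4 * Real.pi * A) (4 * Real.pi * n * (y - 1 / 2)) / (4 * Real.pi * n) := by
  have hn0 : (n : ℝ) ≠ 0 := by exact_mod_cast (by omega : n ≠ 0)
  have h : Real.sin (4 * Real.pi * n * (y - 1 / 2)) = Real.sin (4 * n * Real.pi * y) := by
    rw [← Real.sin_sub_nat_mul_two_pi (4 * n * Real.pi * y) n]
    ring_nf
  rw [oscillatoryShear, centredShear, h]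
  have := Real.pi_ne_zero
  field_simp
  ring

theorem deriv_deriv_oscillatoryShear (A : ℝ) {n : ℕ} (hn : 1 ≤ n) (y : ℝ) :
    deriv (deriv (oscillatoryShear A n)) y =
      -(4 * Real.pi * A * (4 * Real.pi * n) * Real.sin (4 * Real.pi * n * (y - 1 / 2))) := by
  have hn0 : (n : ℝ) ≠ 0 := by exact_mod_cast (by omega : n ≠ 0)
  have hk : 4 * Real.pi * n ≠ 0 := by have := Real.pi_ne_zero; positivity
  have hs : ∀ y : ℝ, HasDerivAt (fun y : ℝ => 4 * Real.pi * n * (y - 1 / 2)) (4 * Real.pi * n) y :=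
    fun y =>
      (((hasDerivAt_id y).sub_const (1 / 2)).const_mul (4 * Real.pi * n)).congr_deriv (mul_one _)
  have h1 : deriv (oscillatoryShear A n) = fun y =>
      1 + 4 * Real.pi * A * Real.cos (4 * Real.pi * n * (y - 1 / 2)) := by
    funext y
    have := (((hasDerivAt_centredShear (4 * Real.pi * A) _).comp y (hs y)).div_const
      (4 * Real.pi * n)).const_add (1 / 2)
    have he : oscillatoryShear A n = fun y => 1 / 2 +
      (centredShear (4 * Real.pi * A) ∘ fun y => 4 * Real.pi * n * (y - 1 / 2)) y
        / (4 * Real.pi * n) := funext (oscillatoryShear_eq A hn)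
    rw [he, this.deriv, mul_div_cancel_right₀ _ hk]
  rw [h1]
  have := ((((Real.hasDerivAt_cos _).comp y (hs y)).const_mul (4 * Real.pi * A)).const_add 1)
  refine this.deriv.trans ?_
  ring

theorem sub_mul_I_mul_rayleighPotential {a : ℝ} (ha : 0 < a) (ha1 : a < 1) (ε s : ℝ) :
    ((centredShear a s : ℂ) - ε * Complex.I) * rayleighPotential a ε s = (a * Real.sin s : ℝ) := by
  rcases eq_or_ne s 0 with rfl | hs
  · by_cases hε : ε = 0
    · simp [hε, centredShear]
    · simp [rayleighPotential, hε]
  · rw [rayleighPotential_of_ne_zero a ε hs,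
      mul_div_cancel₀ _ (sub_mul_I_ne_zero (Or.inl (centredShear_ne_zero ha ha1 hs)))]

/-- The product form avoids dividing by U − c, which vanishes at y = 1/2 when ε = 0, so neutral and
unstable modes are treated alike. -/
theorem deriv_deriv_oscillatoryShear_eq_mul {A : ℝ} (hA : 0 < 4 * Real.pi * A)
    (hA1 : 4 * Real.pi * A < 1) {n : ℕ} (hn : 1 ≤ n) {μ : ℝ} (hμ : 0 ≤ μ) (ε y : ℝ) :
    ((deriv (deriv (oscillatoryShear A n)) y : ℝ) : ℂ) =
      ((oscillatoryShear A n y : ℂ) - (1 / 2 + (ε / (4 * Real.pi * n) : ℝ) * Complex.I)) *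
      ((4 * Real.pi * n : ℝ) ^ 2 * ((μ : ℂ) -
          rayleighPotential (4 * Real.pi * A) ε (4 * Real.pi * n * (y - 1 / 2)))
        - ((4 * Real.pi * n * √μ : ℝ) : ℂ) ^ 2) := by
  have hn0 : (n : ℝ) ≠ 0 := by exact_mod_cast (by omega : n ≠ 0)
  have hk : 4 * Real.pi * n ≠ 0 := by have := Real.pi_ne_zero; positivity
  rw [deriv_deriv_oscillatoryShear A hn, oscillatoryShear_eq A hn]
  set k : ℝ := 4 * Real.pi * n
  have hkc : (k : ℂ) ≠ 0 := by exact_mod_cast hk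
  have h1 := sub_mul_I_mul_rayleighPotential hA hA1 ε (k * (y - 1 / 2))
  have h2 : ((k * √μ : ℝ) : ℂ) ^ 2 = k ^ 2 * μ := by
    rw [← Complex.ofReal_pow, mul_pow, Real.sq_sqrt hμ]
    push_cast; ring
  rw [h2]
  have h3 : ((-(4 * Real.pi * A * k * Real.sin (k * (y - 1 / 2))) : ℝ) : ℂ) =
      -(k * ((4 * Real.pi * A * Real.sin (k * (y - 1 / 2)) : ℝ) : ℂ)) := by
    push_cast; ring
  rw [h3, ← h1]
  push_cast
  field_simp
  ring

theorem isRayleighEigenfunction_of_hasDerivAt {U : ℝ → ℝ} {α : ℝ} {c : ℂ} {P φ ψ : ℝ → ℂ}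
    (hφ : ∀ y ∈ Icc (0 : ℝ) 1, HasDerivAt φ (ψ y) y)
    (hψ : ∀ y ∈ Icc (0 : ℝ) 1, HasDerivAt ψ (P y * φ y) y) (hP : Continuous P)
    (hU : ∀ y, ((deriv (deriv U) y : ℝ) : ℂ) = ((U y : ℂ) - c) * (P y - (α : ℂ) ^ 2))
    (h0 : φ 0 = 0) (h1 : φ 1 = 0) (hne : φ (1 / 2) ≠ 0) :
    IsRayleighEigenfunction U α c φ := by
  have hd : ∀ y ∈ Ioo (0 : ℝ) 1, deriv φ y = ψ y := fun y hy => (hφ y (Ioo_subset_Icc_self hy)).deriv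
  have hdd : ∀ y ∈ Ioo (0 : ℝ) 1, HasDerivAt (deriv φ) (P y * φ y) y := fun y hy =>
    (hψ y (Ioo_subset_Icc_self hy)).congr_of_eventuallyEq
      (Filter.eventuallyEq_of_mem (Ioo_mem_nhds hy.1 hy.2) hd)
  have hc : ContinuousOn φ (Icc 0 1) := fun y hy => (hφ y hy).continuousAt.continuousWithinAt
  refine ⟨hc, ?_, fun y hy => ?_, h0, h1, ⟨1 / 2, by norm_num, hne⟩⟩
  · rw [show (2 : WithTop ℕ∞) = 1 + 1 by norm_num, contDiffOn_succ_iff_deriv_of_isOpen isOpen_Ioo]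
    refine ⟨fun y hy => (hφ y (Ioo_subset_Icc_self hy)).differentiableAt.differentiableWithinAt,
      by simp, ?_⟩
    rw [show (1 : WithTop ℕ∞) = 0 + 1 by norm_num, contDiffOn_succ_iff_deriv_of_isOpen isOpen_Ioo]
    refine ⟨fun y hy => (hdd y hy).differentiableAt.differentiableWithinAt, by simp, ?_⟩
    rw [contDiffOn_zero]
    exact (hP.continuousOn.mul (hc.mono Ioo_subset_Icc_self)).congr fun y hy => (hdd y hy).deriv
  · rw [(hdd y hy).deriv, hU y]
    ring

theorem ofReal_sub_ne_zero {c : ℂ} (hc : 0 < c.im) (x : ℝ) : (x : ℂ) - c ≠ 0 := by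
  intro h
  have := congrArg Complex.im h
  simp at this
  exact hc.ne' this

/-- For Im c > 0 the factor U − c never vanishes, so φ'' is a smooth coefficient times φ. -/
theorem IsRayleighEigenfunction.contDiffOn_top {U : ℝ → ℝ} {α : ℝ} {c : ℂ} {φ : ℝ → ℂ}
    (h : IsRayleighEigenfunction U α c φ) (hU : ContDiff ℝ (⊤ : ℕ∞) U) (hc : 0 < c.im) :
    ContDiffOn ℝ (⊤ : ℕ∞) φ (Ioo 0 1) := by
  have hU2 : ContDiff ℝ (⊤ : ℕ∞) (deriv (deriv U)) :=
    (contDiff_infty_iff_deriv.1 (contDiff_infty_iff_deriv.1 hU).2).2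
  have h2 : ContDiff ℝ (⊤ : ℕ∞) fun y => ((deriv (deriv U) y : ℝ) : ℂ) :=
    Complex.ofRealCLM.contDiff.comp hU2
  have h0 : ContDiff ℝ (⊤ : ℕ∞) fun y => ((U y : ℝ) : ℂ) := Complex.ofRealCLM.contDiff.comp hU
  have hQ : ContDiff ℝ (⊤ : ℕ∞) fun y =>
      (α : ℂ) ^ 2 + ((deriv (deriv U) y : ℝ) : ℂ) * ((U y : ℂ) - c)⁻¹ :=
    contDiff_const.add (h2.mul ((h0.sub contDiff_const).inv fun y => ofReal_sub_ne_zero hc _))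
  have hφ := h.contDiffOn
  rw [show (2 : WithTop ℕ∞) = 1 + 1 by norm_num,
    contDiffOn_succ_iff_deriv_of_isOpen isOpen_Ioo] at hφ
  have hφ' := hφ.2.2.differentiableOn one_ne_zero
  refine (contDiffOn_of_second_order (ψ := deriv φ) isOpen_Ioo.uniqueDiffOn hQ.contDiffOn
    (fun y hy => ?_) fun y hy => ?_).1
  · exact ((hφ.1 y hy).differentiableAt (isOpen_Ioo.mem_nhds hy)).hasDerivAt.hasDerivWithinAt
  · have h1 := ((hφ' y hy).differentiableAt (isOpen_Ioo.mem_nhds hy)).hasDerivAt.hasDerivWithinAt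
      (s := Ioo 0 1)
    have h3 := h.equation y hy
    have h4 := ofReal_sub_ne_zero hc (U y)
    have h5 : deriv (deriv φ) y =
        ((α : ℂ) ^ 2 + ((deriv (deriv U) y : ℝ) : ℂ) * ((U y : ℂ) - c)⁻¹) * φ y := by
      field_simp
      linear_combination -h3
    rwa [h5] at h1

theorem contDiffOn_planeWave {g : ℝ → ℂ} (hg : ContDiffOn ℝ (⊤ : ℕ∞) g (Icc 0 1)) (lam β : ℂ) :
    ContDiffOn ℝ (⊤ : ℕ∞) (fun q : ℝ × ℝ × ℝ =>
      Complex.exp (lam * q.1) * (g q.2.2 * Complex.exp (β * q.2.1)))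
      (univ ×ˢ univ ×ˢ Icc 0 1) := by
  have h1 : ContDiff ℝ (⊤ : ℕ∞) fun q : ℝ × ℝ × ℝ => Complex.exp (lam * q.1) :=
    (contDiff_const.mul (Complex.ofRealCLM.contDiff.comp contDiff_fst)).cexp
  have h2 : ContDiff ℝ (⊤ : ℕ∞) fun q : ℝ × ℝ × ℝ => Complex.exp (β * q.2.1) :=
    (contDiff_const.mul (Complex.ofRealCLM.contDiff.comp (contDiff_fst.comp contDiff_snd))).cexp
  have h3 : ContDiffOn ℝ (⊤ : ℕ∞) (fun q : ℝ × ℝ × ℝ => g q.2.2) (univ ×ˢ univ ×ˢ Icc 0 1) :=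
    hg.comp (contDiff_snd.comp contDiff_snd).contDiffOn fun q hq => hq.2.2
  exact h1.contDiffOn.mul (h3.mul h2.contDiffOn)

/-- The stream function φ(y)exp(iα(x − ct)) gives u = φ' and v = −iαφ, up to the exponential. The
x-momentum equation then fixes p, and the y-momentum equation is the Rayleigh equation. The growth
rate is α·Im c. -/
theorem isLinearlyUnstable_of_hasDerivAt {U : ℝ → ℝ} {α : ℝ} {c : ℂ} {P φ ψ : ℝ → ℂ}
    (hU : ContDiff ℝ (⊤ : ℕ∞) U) (hα : 0 < α) (hc : 0 < c.im)
    (hφ : ∀ y ∈ Icc (0 : ℝ) 1, HasDerivAt φ (ψ y) y)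
    (hψ : ∀ y ∈ Icc (0 : ℝ) 1, HasDerivAt ψ (P y * φ y) y) (hP : ContDiff ℝ (⊤ : ℕ∞) P)
    (hR : ∀ y, ((deriv (deriv U) y : ℝ) : ℂ) = ((U y : ℂ) - c) * (P y - (α : ℂ) ^ 2))
    (h0 : φ 0 = 0) (h1 : φ 1 = 0) (hne : φ (1 / 2) ≠ 0) : IsLinearlyUnstable U := by
  have hU1 := (contDiff_infty_iff_deriv.1 hU).2
  have hUd : ∀ y, HasDerivAt (fun y => (U y : ℂ)) ((deriv U y : ℝ) : ℂ) y := fun y =>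
    ((hU.differentiable (by simp)) y).hasDerivAt.ofReal_comp
  have hUdd : ∀ y, HasDerivAt (fun y => ((deriv U y : ℝ) : ℂ))
      ((deriv (deriv U) y : ℝ) : ℂ) y := fun y =>
    ((hU1.differentiable (by simp)) y).hasDerivAt.ofReal_comp
  obtain ⟨sφ, sψ⟩ := contDiffOn_of_second_order (uniqueDiffOn_Icc one_pos) hP.contDiffOn
    (fun y hy => (hφ y hy).hasDerivWithinAt) (fun y hy => (hψ y hy).hasDerivWithinAt)
  have sU : ContDiff ℝ (⊤ : ℕ∞) fun y => ((U y : ℝ) : ℂ) := Complex.ofRealCLM.contDiff.comp hU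
  have sU1 : ContDiff ℝ (⊤ : ℕ∞) fun y => ((deriv U y : ℝ) : ℂ) :=
    Complex.ofRealCLM.contDiff.comp hU1
  have hαc : (α : ℂ) ≠ 0 := by exact_mod_cast hα.ne'
  let β : ℂ := Complex.I * α
  let lam : ℂ := -(β * c)
  let gv : ℝ → ℂ := fun y => -β * φ y
  let gp : ℝ → ℂ := fun y => -((U y : ℂ) - c) * ψ y + ((deriv U y : ℝ) : ℂ) * φ y
  have sgv : ContDiffOn ℝ (⊤ : ℕ∞) gv (Icc 0 1) := contDiffOn_const.mul sφ
  have sgp : ContDiffOn ℝ (⊤ : ℕ∞) gp (Icc 0 1) :=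
    (((sU.sub contDiff_const).neg.contDiffOn).mul sψ).add (sU1.contDiffOn.mul sφ)
  have hexp : ∀ (γ : ℂ) (x : ℝ), HasDerivAt (fun x : ℝ => Complex.exp (γ * x))
      (Complex.exp (γ * x) * γ) x := fun γ x => by
    have := (((hasDerivAt_id x).ofReal_comp).const_mul γ).cexp
    simpa using this
  have hdt : ∀ (z : ℂ) (t : ℝ), deriv (fun s : ℝ => Complex.exp (lam * s) * z) t =
      Complex.exp (lam * t) * lam * z := fun z t => ((hexp lam t).mul_const z).deriv
  have hdx : ∀ (E z : ℂ) (x : ℝ), deriv (fun s : ℝ => E * (z * Complex.exp (β * s))) x =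
      E * (z * (Complex.exp (β * x) * β)) := fun E z x =>
    (((hexp β x).const_mul z).const_mul E).deriv
  have hdy : ∀ {g : ℝ → ℂ} {g' : ℂ} (E F : ℂ) {y : ℝ}, HasDerivAt g g' y →
      deriv (fun s : ℝ => E * (g s * F)) y = E * (g' * F) := fun E F y hg =>
    ((hg.mul_const F).const_mul E).deriv
  have hper : ∀ x : ℝ, Complex.exp (β * ((x + 2 * Real.pi / α : ℝ) : ℂ)) =
      Complex.exp (β * x) := fun x => by
    rw [← Complex.exp_periodic (β * x)]
    congr 1
    simp only [β]
    push_cast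
    field_simp
  refine ⟨2 * Real.pi / α, by positivity, lam, ?_, fun x y => ψ y * Complex.exp (β * x),
    fun x y => gv y * Complex.exp (β * x), fun x y => gp y * Complex.exp (β * x),
    ⟨0, 1 / 2, by norm_num, Or.inr ?_⟩, ?_⟩
  · have : lam.re = α * c.im := by simp [lam, β]
    rw [this]
    exact mul_pos hα hc
  · simp [gv, β, hαc] at hne ⊢
    exact hne
  · refine ⟨contDiffOn_planeWave sψ lam β, contDiffOn_planeWave sgv lam β,
      contDiffOn_planeWave sgp lam β, fun t x y _ => ?_, fun t x y hy => ?_, fun t x y hy => ?_,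
      fun t x y hy => ?_, fun t x => ?_⟩
    · simp only [hper, and_self]
    · rw [hdt, hdx, hdx]
      simp only [gv, gp, lam]
      ring
    · have hy' := Ioo_subset_Icc_self hy
      have hgp : HasDerivAt gp (-((deriv U y : ℝ) : ℂ) * ψ y + -((U y : ℂ) - c) * (P y * φ y)
          + (((deriv (deriv U) y : ℝ) : ℂ) * φ y + ((deriv U y : ℝ) : ℂ) * ψ y)) y :=
        ((((hUd y).sub_const c).neg).mul (hψ y hy')).add ((hUdd y).mul (hφ y hy'))
      rw [hdt, hdx, hdy _ _ hgp, hR y]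
      simp only [gv, lam, β]
      linear_combination (Complex.exp (-(Complex.I * α * c) * t) * φ y *
        Complex.exp (Complex.I * α * x) * (c - U y) * α ^ 2) * Complex.I_sq
    · have hy' := Ioo_subset_Icc_self hy
      rw [hdx, hdy _ _ ((hφ y hy').const_mul (-β))]
      ring
    · simp [gv, h0, h1]

theorem exists_eigenfunction_of_isTerminalSolution {a k μ ε : ℝ} {φ ψ : ℝ → ℂ} (hk : 0 < k)
    (h : IsTerminalSolution (fun s => (μ : ℂ) - rayleighPotential a ε s) (k / 2) φ ψ)
    (h0 : φ 0 ≠ 0) (hre : (ψ 0 / φ 0).re = 0) :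
    ∃ Φ Ψ : ℝ → ℂ, (∀ y ∈ Icc (0 : ℝ) 1, HasDerivAt Φ (Ψ y) y) ∧
      (∀ y ∈ Icc (0 : ℝ) 1, HasDerivAt Ψ
        ((k : ℂ) ^ 2 * ((μ : ℂ) - rayleighPotential a ε (k * (y - 1 / 2))) * Φ y) y) ∧
      Φ 0 = 0 ∧ Φ 1 = 0 ∧ Φ (1 / 2) = 1 := by
  obtain ⟨F, G, hF, hG, hF0, hF1, hFc⟩ := h.exists_symmetric_extension (half_pos hk)
    (fun s => by simp [rayleighPotential_neg]) h0 hre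
  have hs : ∀ y : ℝ, HasDerivAt (fun y : ℝ => k * (y - 1 / 2)) k y := fun y =>
    (((hasDerivAt_id y).sub_const (1 / 2)).const_mul k).congr_deriv (mul_one _)
  have hmem : ∀ y ∈ Icc (0 : ℝ) 1, k * (y - 1 / 2) ∈ Icc (-(k / 2)) (k / 2) := fun y hy => by
    constructor <;> nlinarith [hy.1, hy.2]
  refine ⟨fun y => F (k * (y - 1 / 2)), fun y => k * G (k * (y - 1 / 2)), fun y hy => ?_,
    fun y hy => ?_, ?_, ?_, by simpa using hFc⟩
  · refine ((hF _ (hmem y hy)).scomp y (hs y)).congr_deriv ?_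
    simp
  · refine (((hG _ (hmem y hy)).scomp y (hs y)).const_mul (k : ℂ)).congr_deriv ?_
    simp only [Complex.real_smul]
    ring
  · rw [← hF0]; ring_nf
  · rw [← hF1]; ring_nf

theorem theorem3p2 :
    ∃ c₀ : ℝ, 0 < c₀ ∧
      ∀ A : ℝ, 1 / (8 * Real.pi) < A → A < 1 / (4 * Real.pi) →
      ∀ n : ℕ, 1 ≤ n →
        IsLinearlyUnstable (oscillatoryShear A n) ∧
        ∃ αn : ℝ, c₀ * n ≤ αn ∧ IsNeutralMode (oscillatoryShear A n) αn (1 / 2) ∧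
          ∃ δ : ℝ, 0 < δ ∧ ∃ c : ℝ → ℂ,
            ContinuousOn c (Set.Ioc (αn - δ) αn) ∧ c αn = 1 / 2 ∧
            ∀ α ∈ Set.Ioo (αn - δ) αn,
              IsUnstableMode (oscillatoryShear A n) α (c α) ∧
              ∀ φ : ℝ → ℂ, IsRayleighEigenfunction (oscillatoryShear A n) α (c α) φ →
                ContDiffOn ℝ (⊤ : ℕ∞) φ (Set.Ioo 0 1) := by
  -- The constant 1 works: k ≥ 12n because π > 3, and √μ₀ ≥ 1/12.
  refine ⟨1, one_pos, fun A hA hA1 n hn => ?_⟩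
  have hpi := Real.pi_pos
  have hpi3 := Real.pi_gt_three
  have hn1 : (1 : ℝ) ≤ n := by exact_mod_cast hn
  have ha : 1 / 2 < 4 * Real.pi * A := by
    rw [div_lt_iff₀ (by positivity)] at hA
    linarith
  have ha1 : 4 * Real.pi * A < 1 := by
    rw [lt_div_iff₀ (by positivity)] at hA1
    linarith
  have ha0 : 0 < 4 * Real.pi * A := by linarith
  set k : ℝ := 4 * Real.pi * n with hkdef
  have hkn : 12 * (n : ℝ) ≤ k := by rw [hkdef]; nlinarith
  have hk : 0 < k := by linarith
  obtain ⟨μ₀, hμ₀, ⟨φ₀, ψ₀, hs₀, hne₀, hre₀⟩, δ, hδ, hδμ, e, hec, he0, he⟩ :=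
    exists_unstable_branch ha ha1 (ℓ := k / 2) (by linarith)
  have hμ₀0 : 0 < μ₀ := by linarith
  have hU := contDiff_oscillatoryShear A n
  have hPc : ∀ μ ε : ℝ, Continuous fun y : ℝ =>
      (k : ℂ) ^ 2 * ((μ : ℂ) - rayleighPotential (4 * Real.pi * A) ε (k * (y - 1 / 2))) :=
    fun μ ε => by
      have := continuous_rayleighPotential ha0 ha1 ε
      fun_prop
  have hPs : ∀ {ε : ℝ} (μ : ℝ), ε ≠ 0 → ContDiff ℝ (⊤ : ℕ∞) fun y : ℝ =>
      (k : ℂ) ^ 2 * ((μ : ℂ) - rayleighPotential (4 * Real.pi * A) ε (k * (y - 1 / 2))) :=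
    fun μ hε => contDiff_const.mul (contDiff_const.sub
      ((contDiff_rayleighPotential _ hε).comp (contDiff_const.mul (contDiff_id.sub contDiff_const))))
  -- The branch e is read through α = k√μ; the interval (μ₀ − δ, μ₀] becomes (k√(μ₀ − δ), k√μ₀].
  let c : ℝ → ℂ := fun α => 1 / 2 + (e ((α / k) ^ 2) / k : ℝ) * Complex.I
  have hcim : ∀ α, (c α).im = e ((α / k) ^ 2) / k := fun α => by simp [c]
  have hδ' : 0 < k * √μ₀ - k * √(μ₀ - δ) := by
    have : √(μ₀ - δ) < √μ₀ := Real.sqrt_lt_sqrt (by linarith) (by linarith)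
    nlinarith
  have hμ : ∀ α, k * √μ₀ - (k * √μ₀ - k * √(μ₀ - δ)) < α → 0 < α ∧ μ₀ - δ < (α / k) ^ 2 ∧
      k * √((α / k) ^ 2) = α := fun α hα => by
    rw [sub_sub_cancel] at hα
    have h1 : 0 < α := lt_of_le_of_lt (by positivity) hα
    refine ⟨h1, ?_, ?_⟩
    · rw [← Real.sqrt_lt' (by positivity), lt_div_iff₀ hk]
      linarith
    · rw [Real.sqrt_sq (by positivity), mul_div_cancel₀ _ hk.ne']
  have hμle : ∀ α, 0 < α → α ≤ k * √μ₀ → (α / k) ^ 2 ≤ μ₀ := fun α h0 hα => by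
    rw [← Real.le_sqrt (by positivity) hμ₀0.le, div_le_iff₀ hk]
    linarith
  have hμlt : ∀ α, 0 < α → α < k * √μ₀ → (α / k) ^ 2 < μ₀ := fun α h0 hα => by
    rw [← Real.lt_sqrt (by positivity), div_lt_iff₀ hk]
    linarith
  have key : ∀ α ∈ Ioo (k * √μ₀ - (k * √μ₀ - k * √(μ₀ - δ))) (k * √μ₀),
      0 < α ∧ 0 < (c α).im ∧ IsLinearlyUnstable (oscillatoryShear A n) ∧
        ∃ φ, IsRayleighEigenfunction (oscillatoryShear A n) α (c α) φ := fun α hα => by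
    obtain ⟨h1, h2, h3⟩ := hμ α hα.1
    obtain ⟨hε, φ, ψ, hs, hne, hre⟩ := he _ ⟨h2, hμlt α h1 hα.2⟩
    obtain ⟨Φ, Ψ, hΦ, hΨ, hΦ0, hΦ1, hΦc⟩ :=
      exists_eigenfunction_of_isTerminalSolution hk hs hne hre
    have hcα : 0 < (c α).im := by
      rw [hcim]
      positivity
    have hne' : Φ (1 / 2) ≠ 0 := by rw [hΦc]; exact one_ne_zero
    have hR := deriv_deriv_oscillatoryShear_eq_mul ha0 ha1 hn
      (sq_nonneg (α / k)) (e ((α / k) ^ 2))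
    simp only [← hkdef, h3] at hR
    exact ⟨h1, hcα, isLinearlyUnstable_of_hasDerivAt (c := c α) hU h1 hcα hΦ hΨ (hPs _ hε.ne') hR
      hΦ0 hΦ1 hne', Φ, isRayleighEigenfunction_of_hasDerivAt hΦ hΨ (hPc _ _) hR hΦ0 hΦ1 hne'⟩
  refine ⟨?_, k * √μ₀, ?_, ⟨⟨by positivity, ?_⟩, by simp⟩, _, hδ', c, ?_, ?_, fun α hα => ?_⟩
  · exact (key ((k * √μ₀ - (k * √μ₀ - k * √(μ₀ - δ)) + k * √μ₀) / 2)
      ⟨by linarith, by linarith⟩).2.2.1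
  · have h12 : 1 / 12 ≤ √μ₀ := Real.le_sqrt_of_sq_le (by linarith)
    nlinarith
  · obtain ⟨Φ, Ψ, hΦ, hΨ, hΦ0, hΦ1, hΦc⟩ :=
      exists_eigenfunction_of_isTerminalSolution hk hs₀ hne₀ hre₀
    have hR := deriv_deriv_oscillatoryShear_eq_mul ha0 ha1 hn hμ₀0.le 0
    simp only [← hkdef, zero_div, Complex.ofReal_zero, zero_mul, add_zero] at hR
    exact ⟨Φ, isRayleighEigenfunction_of_hasDerivAt hΦ hΨ (hPc μ₀ 0) hR hΦ0 hΦ1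
      (by rw [hΦc]; exact one_ne_zero)⟩
  · have h1 : ContinuousOn (fun α : ℝ => e ((α / k) ^ 2))
        (Ioc (k * √μ₀ - (k * √μ₀ - k * √(μ₀ - δ))) (k * √μ₀)) :=
      hec.comp (by fun_prop) fun α hα => by
        obtain ⟨h1, h2, -⟩ := hμ α hα.1
        exact ⟨h2, hμle α h1 hα.2⟩
    exact continuousOn_const.add ((Complex.continuous_ofReal.comp_continuousOn
      (h1.div_const k)).mul continuousOn_const)
  · simp only [c]
    rw [mul_div_cancel_left₀ _ hk.ne', Real.sq_sqrt hμ₀0.le, he0]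
    simp
  · obtain ⟨h1, h2, -, h3⟩ := key α hα
    exact ⟨⟨⟨h1, h3⟩, h2⟩, fun φ hφ => hφ.contDiffOn_top hU h2⟩
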